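/- **Setting.** Let $\mathcal X\subseteq\mathbb R^p$, $\mathcal Y\subseteq\mathbb R^d$ be nonempty, convex, closed and bounded, $\mathcal Z=\mathcal X\times\mathcal Y$, $\alpha,\delta>0$, and let $f(z),g(z)$, $z=(x,y)$, be real functions that are differentiable at the points of $\mathcal Z$. Put $\tilde g(x,y)=g(x,y)+\frac{\alpha}{2}\|y\|^2$, $\tilde g^*(x)=\min_{y\in\mathcal Y}\tilde g(x,y)$ and $\tilde h(x,y)=g(x,y)-\tilde g^*(x)-\delta$. The relaxed problem is $\min_{z\in\mathcal Z} f(z)$ subject to $\tilde h(z)\le 0$. **Assumption 1.** For some $\rho_f,\rho_g\ge0$ and all $z,z'\in\mathcal Z$: $\|\nabla f(z)-\nabla f(z')\|\le\rho_f\|z-z'\|$ and $\|\nabla g(z)-\nabla g(z')\|\le\rho_g\|z-z'\|$; for each $x\in\mathcal X$ the function $g(x,\cdot)$ is convex on $\mathcal Y$; and $g(x',y')\ge g(x,y)+\langle\nabla_xg(x,y),x'-x\rangle+\langle\nabla_yg(x,y),y'-y\rangle-\frac{\rho_g}{2}\|x-x'\|^2$ for all $x,x'\in\mathcal X$, $y,y'\in\mathcal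 Y$. **Assumption 2.** On $\mathcal Z$, $f$ is $\mu$-strongly convex with $\mu>0$ and $\tilde h$ is convex. **Constants.** $D_{\mathcal Z}=\operatorname{diam}\mathcal Z$, $D_f=\sup_{z,z'\in\mathcal Z}|f(z)-f(z')|$, $L_g=\sup_{z\in\mathcal Z}\|\nabla g(z)\|$ (assumed positive), $R=\sup_{y\in\mathcal Y}\|y\|$, $\rho_h=\rho_g(2+\rho_g/\alpha)$, $B\ge D_f/\delta+1$, $t_0=2(\rho_f+B\rho_h)/\mu$, and $$\gamma_t=t+t_0+1,\quad \eta_t=\tfrac{\mu(t+t_0+1)}{2},\quad \tau_t=\tfrac{32L_g^2}{\mu(t+1)},\quad \theta_t=\tfrac{t+t_0}{t+t_0+1}.$$ **Algorithm (PDBO).** Start from any $z_0=z_{-1}\in\mathcal Z$ and $\lambda_0\in[0,B]$. In iteration $t=0,1,\dots,T-1$, from any $\hat y_0\in\mathcal Y$ (possibly depending on $t$) perform $N$ steps $$\hat y_{n+1}=\Pi_{\mathcal Y}\big(\hat y_n-\tfrac{2}{\rho_g+2\alpha}(\nabla_yg(x_t,\hat y_n)+\alpha\hat y_n)\big),$$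 put $\hat h(z_t)=g(z_t)-\tilde g(x_t,\hat y_N)-\delta$ and $\hat\nabla\tilde h(z_t)=\nabla g(z_t)-(\nabla_xg(x_t,\hat y_N);0)$, and update $$\lambda_{t+1}=\Pi_{[0,B]}\big(\lambda_t+\tfrac1{\tau_t}((1+\theta_t)\hat h(z_t)-\theta_t\hat h(z_{t-1}))\big),\qquad z_{t+1}=\Pi_{\mathcal Z}\big(z_t-\tfrac1{\eta_t}(\nabla f(z_t)+\lambda_{t+1}\hat\nabla\tilde h(z_t))\big),$$ where $\hat h(z_{t-1})$ is the value computed in the previous iteration and $\hat h(z_{-1})=\hat h(z_0)$. The output is $\bar z=\frac1{\Gamma_T}\sum_{t=0}^{T-1}\gamma_tz_{t+1}$ with $\Gamma_T=\sum_{t=0}^{T-1}\gamma_t$. **Theorem 1.** Under Assumptions 1 and 2 the relaxed problem has exactly one global minimizer $z^*$, and for all $T\ge1$ and $N\ge0$, with $E_N=(\rho_gD_{\mathcal Z}+4(L_g+\alpha R))\,B\,D_{\mathcal Z}\big(1-\tfrac{\alpha}{\rho_g+2\alpha}\big)^N$, $$f(\bar z)-f(z^*)\le\frac{2L_gBD_{\mathcal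 Z}+\gamma_0\tau_0\lambda_0^2+\gamma_0(\eta_0-\mu)\|z^*-z_0\|^2}{T^2}+E_N,$$ $$[\tilde h(\bar z)]_+\le\frac{2L_gBD_{\mathcal Z}+\gamma_0\tau_0B^2+\gamma_0(\eta_0-\mu)D_{\mathcal Z}^2}{T^2}+E_N,$$ $$\|\bar z-z^*\|^2\le\frac{2\gamma_0\tau_0B^2+2\gamma_0(\eta_0-\mu)D_{\mathcal Z}^2}{\mu T^2}+\frac{2}{\mu}E_N .$$ In particular, all three quantities are $O(1/T^2)+O\big((1-\frac{\alpha}{\rho_g+2\alpha})^N\big)$ with constants independent of $T$ and $N$. -/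

import Mathlib

noncomputable section

namespace PDBO

/-- The Euclidean space `ℝ^p × ℝ^d = ℝ^(p+d)` of pairs `z = (x, y)`, with the Euclidean norm. -/
abbrev Pt (p d : ℕ) : Type :=
  WithLp 2 (EuclideanSpace ℝ (Fin p) × EuclideanSpace ℝ (Fin d))

/-- The pair `z = (x, y)`. -/
def pt {p d : ℕ} (x : EuclideanSpace ℝ (Fin p)) (y : EuclideanSpace ℝ (Fin d)) : Pt p d :=
  WithLp.toLp 2 (x, y)

/-- A nearest point of `K` to `u` (the Euclidean projection when `K` is nonempty, closed and
convex). -/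
def proj {E : Type*} [NormedAddCommGroup E] (K : Set E) (u : E) : E :=
  Classical.epsilon fun v => v ∈ K ∧ ∀ w ∈ K, ‖u - v‖ ≤ ‖u - w‖

/-- The data of a bilevel problem: supports `X`, `Y`, outer objective `f`, inner objective `g`,
smoothing parameter `alpha` and relaxation parameter `delta`. -/
structure Problem (p d : ℕ) where
  X : Set (EuclideanSpace ℝ (Fin p))
  Y : Set (EuclideanSpace ℝ (Fin d))
  f : Pt p d → ℝ
  g : Pt p d → ℝ
  alpha : ℝ
  delta : ℝ

namespace Problem

variable {p d : ℕ} (P : Problem p d)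

/-- `Z = X × Y`. -/
def Z : Set (Pt p d) := {z | z.fst ∈ P.X ∧ z.snd ∈ P.Y}

/-- The partial gradient of `g` in `x`. -/
def gradX (z : Pt p d) : EuclideanSpace ℝ (Fin p) := (gradient P.g z).fst

/-- The partial gradient of `g` in `y`. -/
def gradY (z : Pt p d) : EuclideanSpace ℝ (Fin d) := (gradient P.g z).snd

/-- The regularized inner objective `g(x, y) + (α/2) ‖y‖²`. -/
def gReg (x : EuclideanSpace ℝ (Fin p)) (y : EuclideanSpace ℝ (Fin d)) : ℝ :=
  P.g (pt x y) + P.alpha / 2 * ‖y‖ ^ 2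

/-- The smoothed value function: the minimum of `gReg x` over `Y`. -/
def gStar (x : EuclideanSpace ℝ (Fin p)) : ℝ := sInf (P.gReg x '' P.Y)

/-- The relaxed constraint function. -/
def h (z : Pt p d) : ℝ := P.g z - P.gStar z.fst - P.delta

/-- `zs` is a global minimizer of `f` over `{z ∈ Z : h z ≤ 0}`. -/
def IsSolution (zs : Pt p d) : Prop :=
  zs ∈ P.Z ∧ P.h zs ≤ 0 ∧ ∀ z ∈ P.Z, P.h z ≤ 0 → P.f zs ≤ P.f z

/-- Standing assumptions on the data (continuity of the gradients on `Z` comes with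
`GradLipschitz`). -/
structure Standing : Prop where
  X_nonempty : P.X.Nonempty
  X_convex : Convex ℝ P.X
  X_closed : IsClosed P.X
  X_bounded : Bornology.IsBounded P.X
  Y_nonempty : P.Y.Nonempty
  Y_convex : Convex ℝ P.Y
  Y_closed : IsClosed P.Y
  Y_bounded : Bornology.IsBounded P.Y
  f_diff : ∀ z ∈ P.Z, DifferentiableAt ℝ P.f z
  g_diff : ∀ z ∈ P.Z, DifferentiableAt ℝ P.g z
  alpha_pos : 0 < P.alpha
  delta_pos : 0 < P.delta

/-- `f` and `g` are gradient Lipschitz on `Z`, `g` is convex in `y`, and `g` is bounded below by its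
linearizations up to a quadratic term in `x`. -/
structure GradLipschitz (rhoF rhoG : ℝ) : Prop where
  rhoF_nonneg : 0 ≤ rhoF
  rhoG_nonneg : 0 ≤ rhoG
  f_lip : ∀ z ∈ P.Z, ∀ z' ∈ P.Z, ‖gradient P.f z - gradient P.f z'‖ ≤ rhoF * ‖z - z'‖
  g_lip : ∀ z ∈ P.Z, ∀ z' ∈ P.Z, ‖gradient P.g z - gradient P.g z'‖ ≤ rhoG * ‖z - z'‖
  g_convex : ∀ x ∈ P.X, ConvexOn ℝ P.Y fun y => P.g (pt x y)
  g_lower : ∀ x ∈ P.X, ∀ x' ∈ P.X, ∀ y ∈ P.Y, ∀ y' ∈ P.Y,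
    P.g (pt x y) + inner ℝ (P.gradX (pt x y)) (x' - x) + inner ℝ (P.gradY (pt x y)) (y' - y)
      - rhoG / 2 * ‖x - x'‖ ^ 2 ≤ P.g (pt x' y')

/-- `f` is `mu`-strongly convex and the relaxed constraint function is convex, on `Z`. -/
structure StrongConvexity (mu : ℝ) : Prop where
  mu_pos : 0 < mu
  f_strong : StrongConvexOn P.Z mu P.f
  h_convex : ConvexOn ℝ P.Z P.h

/-- The diameter of `Z`. -/
def DZ : ℝ := Metric.diam P.Z

/-- The oscillation of `f` over `Z`. -/
def Df : ℝ := sSup {r | ∃ z ∈ P.Z, ∃ z' ∈ P.Z, r = |P.f z - P.f z'|}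

/-- The supremum of `‖∇g‖` over `Z`. -/
def Lg : ℝ := sSup ((fun z => ‖gradient P.g z‖) '' P.Z)

/-- The supremum of `‖y‖` over `Y`. -/
def RY : ℝ := sSup ((fun y => ‖y‖) '' P.Y)

/-- `n` steps of projected gradient descent on `gReg x` over `Y`, with stepsize
`2 / (rhoG + 2 α)`, started at `y0`. -/
def innerIter (rhoG : ℝ) (x : EuclideanSpace ℝ (Fin p)) (y0 : EuclideanSpace ℝ (Fin d)) :
    ℕ → EuclideanSpace ℝ (Fin d)
  | 0 => y0
  | n + 1 =>
    let y := innerIter rhoG x y0 n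
    proj P.Y (y - (2 / (rhoG + 2 * P.alpha)) • (P.gradY (pt x y) + P.alpha • y))

/-- The estimate of `h z` obtained from an estimate `yh` of the inner minimizer. -/
def hHat (z : Pt p d) (yh : EuclideanSpace ℝ (Fin d)) : ℝ :=
  P.g z - P.gReg z.fst yh - P.delta

/-- The estimate of the gradient of `h` at `z` obtained from an estimate `yh` of the inner
minimizer. -/
def gradHHat (z : Pt p d) (yh : EuclideanSpace ℝ (Fin d)) : Pt p d :=
  gradient P.g z - pt (P.gradX (pt z.fst yh)) 0

end Problem

/-- The state of the algorithm before iteration `t`: the primal iterate `z_t`, the dual iterate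
`λ_t`, and the estimate of `h(z_{t-1})` computed in the previous iteration. -/
structure State (p d : ℕ) where
  z : Pt p d
  lam : ℝ
  hPrev : ℝ

/-- The primal-dual bilevel optimizer with dual box `[0, B]`, stepsizes `1 / eta t` and `1 / tau t`,
acceleration weights `theta t`, `N` inner steps started at `yinit t` in iteration `t`, and initial
point `z_{-1} = z_0 = z0`, `λ_0 = lam0`. -/
def run {p d : ℕ} (P : Problem p d) (rhoG B : ℝ) (eta tau theta : ℕ → ℝ) (N : ℕ)
    (yinit : ℕ → EuclideanSpace ℝ (Fin d)) (z0 : Pt p d) (lam0 : ℝ) : ℕ → State p d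
  | 0 => ⟨z0, lam0, P.hHat z0 (P.innerIter rhoG z0.fst (yinit 0) N)⟩
  | t + 1 =>
    let s := run P rhoG B eta tau theta N yinit z0 lam0 t
    let yh := P.innerIter rhoG s.z.fst (yinit t) N
    let hh := P.hHat s.z yh
    let lam' := proj (Set.Icc 0 B)
      (s.lam + (1 / tau t) * ((1 + theta t) * hh - theta t * s.hPrev))
    let z' := proj P.Z
      (s.z - (1 / eta t) • (gradient P.f s.z + lam' • P.gradHHat s.z yh))
    ⟨z', lam', hh⟩

/-- The weighted average `(∑_{t<T} γ_t z_{t+1}) / ∑_{t<T} γ_t`. -/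
def average {p d : ℕ} (gamma : ℕ → ℝ) (z : ℕ → Pt p d) (T : ℕ) : Pt p d :=
  (1 / ∑ t ∈ Finset.range T, gamma t) • ∑ t ∈ Finset.range T, gamma t • z (t + 1)

/-- `ρ_h = ρ_g (2 + ρ_g / α)`. -/
def rhoH (rhoG alpha : ℝ) : ℝ := rhoG * (2 + rhoG / alpha)

/-- The shift `t₀ = 2 (ρ_f + B ρ_h) / μ`. -/
def shift (mu rhoF rhoG alpha B : ℝ) : ℝ := 2 * (rhoF + B * rhoH rhoG alpha) / mu

/-- Output weights `γ_t = t + t₀ + 1`. -/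
def gammaSeq (t0 : ℝ) (t : ℕ) : ℝ := t + t0 + 1

/-- Inverse primal stepsizes `η_t = μ (t + t₀ + 1) / 2`. -/
def etaSeq (mu t0 : ℝ) (t : ℕ) : ℝ := mu * (t + t0 + 1) / 2

/-- Inverse dual stepsizes `τ_t = 32 L_g² / (μ (t + 1))`. -/
def tauSeq (mu L : ℝ) (t : ℕ) : ℝ := 32 * L ^ 2 / (mu * (t + 1))

/-- Acceleration weights `θ_t = (t + t₀) / (t + t₀ + 1)`. -/
def thetaSeq (t0 : ℝ) (t : ℕ) : ℝ := (t + t0) / (t + t0 + 1)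

end PDBO

end

namespace PDBO

/-! Everything follows from one family of estimates, `gap_le`: for every fixed `lam` in `[0, B]`,
the Lagrangian gap `f zbar + lam * h zbar - f zs` is at most a constant over `T²` plus the bias. The
points `pt x (yStar x)` satisfy Slater's condition with margin `delta`, so there is a multiplier `l
≤ Df / delta ≤ B - 1`. Taking `lam = 0` bounds the objective. Taking `lam = l` bounds the distance,
because the Lagrangian at `l` is strongly convex and minimized at `zs`. Taking `lam = l + 1` bounds
the violation, because the gap at `l` is nonnegative.

The gap estimate is an accelerated primal-dual argument. `primal_dual_step_le` combines strong
convexity, smoothness and the three-point inequalities of the primal and dual projections.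
`sum_gammaSeq_mul_le` adds the steps with weights `γ_t`, for which the distances telescope and the
momentum terms are absorbed by Young's inequality. The weights grow linearly, so their sum is at
least `T² / 2`; this is the rate.

Two facts feed the step. First, two-sided quadratic expansions of `gStar`, in the spirit of
Danskin's theorem, let `gradH` act as a gradient of `h` without any differentiability of `h`.
Second, the inner iteration contracts towards `yStar`. The contraction rests on cocoercivity of
`gradY`, proved in `inner_sub_smul_le_of_convex_smooth` from convexity and smoothness on `Y` alone.
-/

/-- Let `s → 0`. This serves every first-order argument below: perturb along a segment by `s`,
divide by `s`, discard the remainder. -/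
theorem le_of_forall_le_add_mul {A b C : ℝ} (H : ∀ s : ℝ, 0 < s → s ≤ 1 → A ≤ b + s * C) :
    A ≤ b := by
  refine le_of_forall_pos_le_add fun ε hε => ?_
  have hC : 0 < |C| + 1 := by positivity
  have hs : 0 < min 1 (ε / (|C| + 1)) := lt_min one_pos (by positivity)
  have h1 := H _ hs (min_le_left _ _)
  have h2 : min 1 (ε / (|C| + 1)) * C ≤ ε / (|C| + 1) * (|C| + 1) := by
    calc _ ≤ min 1 (ε / (|C| + 1)) * (|C| + 1) := by
            gcongr
            linarith [le_abs_self C]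
      _ ≤ _ := by gcongr; exact min_le_right _ _
  rw [div_mul_cancel₀ _ hC.ne'] at h2
  linarith

/-! ### Projections, the descent lemma and strong convexity -/

section Generic

variable {E : Type*} [NormedAddCommGroup E] [InnerProductSpace ℝ E]

theorem norm_add_smul_sub_sq (a b c : E) (s : ℝ) :
    ‖a - (b + s • c)‖ ^ 2 = ‖a - b‖ ^ 2 - 2 * s * inner ℝ (a - b) c + s ^ 2 * ‖c‖ ^ 2 := by
  rw [← sub_sub, norm_sub_sq_real, inner_smul_right, norm_smul, mul_pow, Real.norm_eq_abs, sq_abs]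
  ring

theorem continuousOn_of_differentiableAt {S : Set E} {f : E → ℝ}
    (hd : ∀ z ∈ S, DifferentiableAt ℝ f z) : ContinuousOn f S :=
  fun z hz => (hd z hz).continuousAt.continuousWithinAt

theorem add_smul_sub_mem_of_convex {S : Set E} (hS : Convex ℝ S) {a b : E} (ha : a ∈ S)
    (hb : b ∈ S) {s : ℝ} (h0 : 0 ≤ s) (h1 : s ≤ 1) : a + s • (b - a) ∈ S :=
  hS.add_smul_sub_mem ha hb ⟨h0, h1⟩

theorem proj_mem_and_le {K : Set E} (hne : K.Nonempty) (hc : IsComplete K) (hK : Convex ℝ K)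
    (u : E) : proj K u ∈ K ∧ ∀ w ∈ K, ‖u - proj K u‖ ≤ ‖u - w‖ := by
  obtain ⟨v, hv, hv'⟩ := exists_norm_eq_iInf_of_complete_convex hne hc hK u
  have hex : ∃ v, v ∈ K ∧ ∀ w ∈ K, ‖u - v‖ ≤ ‖u - w‖ := by
    refine ⟨v, hv, fun w hw => ?_⟩
    rw [hv']
    exact ciInf_le (f := fun w : K => ‖u - w‖) ⟨0, by rintro _ ⟨w, rfl⟩; positivity⟩ ⟨w, hw⟩
  exact Classical.epsilon_spec hex

theorem inner_sub_proj_le {K : Set E} (hne : K.Nonempty) (hc : IsComplete K) (hK : Convex ℝ K)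
    (u : E) {w : E} (hw : w ∈ K) : inner ℝ (u - proj K u) (w - proj K u) ≤ 0 := by
  obtain ⟨hv, hmin⟩ := proj_mem_and_le hne hc hK u
  refine le_of_forall_le_add_mul (C := ‖w - proj K u‖ ^ 2 / 2) fun s h0 h1 => ?_
  have h2 := hmin _ (add_smul_sub_mem_of_convex hK hv hw h0.le h1)
  have h3 := pow_le_pow_left₀ (norm_nonneg _) h2 2
  rw [norm_add_smul_sub_sq] at h3
  have h4 : s * (2 * inner ℝ (u - proj K u) (w - proj K u)) ≤ s * (s * ‖w - proj K u‖ ^ 2) := by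
    linarith
  have := le_of_mul_le_mul_left h4 h0
  linarith

/-- The three-point inequality for a projected step `u ↦ proj K (u - c⁻¹ • v)`. -/
theorem inner_proj_step_le {K : Set E} (hne : K.Nonempty) (hc : IsComplete K) (hK : Convex ℝ K)
    {c : ℝ} (hc0 : 0 < c) (u v : E) {w : E} (hw : w ∈ K) :
    inner ℝ v (proj K (u - (1 / c) • v) - w) ≤
      c / 2 * (‖w - u‖ ^ 2 - ‖proj K (u - (1 / c) • v) - u‖ ^ 2
        - ‖w - proj K (u - (1 / c) • v)‖ ^ 2) := by
  have h := inner_sub_proj_le hne hc hK (u - (1 / c) • v) hw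
  set q := proj K (u - (1 / c) • v)
  have e1 : ‖w - u‖ ^ 2 = ‖w - q‖ ^ 2 + 2 * inner ℝ (w - q) (q - u) + ‖q - u‖ ^ 2 := by
    rw [← norm_add_sq_real, sub_add_sub_cancel]
  have e2 : inner ℝ (u - (1 / c) • v - q) (w - q)
      = - inner ℝ (w - q) (q - u) + (1 / c) * inner ℝ v (q - w) := by
    have : u - (1 / c) • v - q = -(q - u) - (1 / c) • v := by abel
    rw [this, inner_sub_left, inner_neg_left, real_inner_smul_left, real_inner_comm,
      ← neg_sub w q, inner_neg_right]
    ring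
  rw [e2] at h
  have h3 : c * ((1 / c) * inner ℝ v (q - w)) ≤ c * inner ℝ (w - q) (q - u) := by
    gcongr; linarith
  rw [← mul_assoc, mul_one_div_cancel hc0.ne', one_mul] at h3
  rw [e1]
  linarith

/-- Along the segment, `f` minus its linear part and minus the quadratic has nonpositive derivative.
Only points of `S` are visited. -/
theorem sub_sub_inner_le_of_lipschitz [CompleteSpace E] {S : Set E} (hS : Convex ℝ S) {f : E → ℝ}
    {G : E → E} {rho : ℝ} (hd : ∀ z ∈ S, HasGradientAt f (G z) z)
    (hl : ∀ z ∈ S, ∀ z' ∈ S, ‖G z - G z'‖ ≤ rho * ‖z - z'‖) {a b : E} (ha : a ∈ S) (hb : b ∈ S) :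
    f b - f a - inner ℝ (G a) (b - a) ≤ rho / 2 * ‖b - a‖ ^ 2 := by
  have hmem : ∀ s ∈ Set.Icc (0 : ℝ) 1, a + s • (b - a) ∈ S := fun s hs =>
    hS.add_smul_sub_mem ha hb hs
  let χ : ℝ → ℝ := fun s => f (a + s • (b - a)) - s * inner ℝ (G a) (b - a)
    - rho / 2 * s ^ 2 * ‖b - a‖ ^ 2
  have hder : ∀ s ∈ Set.Icc (0 : ℝ) 1, HasDerivAt χ (inner ℝ (G (a + s • (b - a))) (b - a)
      - inner ℝ (G a) (b - a) - rho * s * ‖b - a‖ ^ 2) s := by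
    intro s hs
    have h1 : HasDerivAt (fun s : ℝ => a + s • (b - a)) (b - a) s := by
      simpa using ((hasDerivAt_id s).smul_const (b - a)).const_add a
    have h2 := (hd _ (hmem s hs)).hasFDerivAt.comp_hasDerivAt s h1
    have h3 := (hasDerivAt_id s).mul_const (inner ℝ (G a) (b - a))
    have h4 := (((hasDerivAt_id s).pow 2).const_mul (rho / 2)).mul_const (‖b - a‖ ^ 2)
    refine ((h2.sub h3).sub h4).congr_deriv ?_
    simp only [InnerProductSpace.toDual_apply_apply, id]
    push_cast
    ring
  have hanti : AntitoneOn χ (Set.Icc 0 1) := by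
    refine antitoneOn_of_deriv_nonpos (convex_Icc 0 1)
      (fun s hs => (hder s hs).continuousAt.continuousWithinAt)
      (fun s hs => (hder s (interior_subset hs)).differentiableAt.differentiableWithinAt) ?_
    intro s hs
    have hs' := interior_subset hs
    rw [(hder s hs').deriv, ← inner_sub_left]
    have h1 := real_inner_le_norm (G (a + s • (b - a)) - G a) (b - a)
    have h2 := hl _ (hmem s hs') a ha
    rw [add_sub_cancel_left, norm_smul, Real.norm_eq_abs, abs_of_nonneg hs'.1] at h2
    have h3 := mul_le_mul_of_nonneg_right h2 (norm_nonneg (b - a))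
    nlinarith
  have := hanti (Set.left_mem_Icc.2 zero_le_one) (Set.right_mem_Icc.2 zero_le_one) zero_le_one
  simp only [χ, one_smul, zero_smul, add_sub_cancel, add_zero] at this
  linarith

theorem abs_sub_sub_inner_le_of_lipschitz [CompleteSpace E] {S : Set E} (hS : Convex ℝ S)
    {f : E → ℝ} {rho : ℝ} (hd : ∀ z ∈ S, DifferentiableAt ℝ f z)
    (hl : ∀ z ∈ S, ∀ z' ∈ S, ‖gradient f z - gradient f z'‖ ≤ rho * ‖z - z'‖)
    {a b : E} (ha : a ∈ S) (hb : b ∈ S) :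
    |f b - f a - inner ℝ (gradient f a) (b - a)| ≤ rho / 2 * ‖b - a‖ ^ 2 := by
  refine abs_le'.2 ⟨sub_sub_inner_le_of_lipschitz hS (fun z hz => (hd z hz).hasGradientAt) hl ha hb,
    ?_⟩
  have := sub_sub_inner_le_of_lipschitz (f := fun z => - f z) (G := fun z => - gradient f z)
    (rho := rho) hS (fun z hz => ?_) (fun z hz z' hz' => ?_) ha hb
  · rw [inner_neg_left] at this
    linarith
  · have h := (hd z hz).hasGradientAt.hasFDerivAt.neg
    rw [hasGradientAt_iff_hasFDerivAt, map_neg]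
    exact h
  · rw [neg_sub_neg, norm_sub_rev]
    exact hl z hz z' hz'

/-- A strongly convex function lies above any of its first-order expansions. -/
theorem StrongConvexOn.add_inner_le {S : Set E} {m : ℝ} {F : E → ℝ} (hF : StrongConvexOn S m F)
    {v a b : E} {C : ℝ} (ha : a ∈ S) (hb : b ∈ S)
    (hlow : ∀ w ∈ S, F a + inner ℝ v (w - a) - C * ‖w - a‖ ^ 2 ≤ F w) :
    F a + inner ℝ v (b - a) + m / 2 * ‖b - a‖ ^ 2 ≤ F b := by
  -- The quadratic error is of order `s²` on the segment, so it vanishes after division by `s` and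
  -- the size of `C` plays no role.
  refine le_of_forall_le_add_mul (C := (m / 2 + C) * ‖b - a‖ ^ 2) fun s h0 h1 => ?_
  have h2 := hF.2 ha hb (sub_nonneg.2 h1) h0.le (by ring)
  have e : (1 - s) • a + s • b = a + s • (b - a) := by
    rw [sub_smul, one_smul, smul_sub]; abel
  have h3 := hlow _ (add_smul_sub_mem_of_convex hF.1 ha hb h0.le h1)
  rw [e, norm_sub_rev] at h2
  rw [add_sub_cancel_left, inner_smul_right, norm_smul, mul_pow, Real.norm_eq_abs, sq_abs] at h3
  simp only [smul_eq_mul] at h2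
  have h4 : s * (F a + inner ℝ v (b - a) + m / 2 * ‖b - a‖ ^ 2)
      ≤ s * (F b + s * ((m / 2 + C) * ‖b - a‖ ^ 2)) := by
    nlinarith
  exact le_of_mul_le_mul_left h4 h0

/-! ### Cocoercivity on a convex set, possibly with empty interior -/

section Cocoercive

variable {S : Set E} {φ : E → ℝ} {G : E → E} {rho : ℝ}

/-- Sandwich `φ` at the midpoint `± u`: at each of the two points, the upper bound from one endpoint
meets the lower bound from the other. Adding cancels the values of `φ`. The bound is sharpest for
`‖u‖ = ‖b - a‖ / 2`. -/
theorem four_point_inner_le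
    (hlow : ∀ a ∈ S, ∀ b ∈ S, φ a + inner ℝ (G a) (b - a) ≤ φ b)
    (hup : ∀ a ∈ S, ∀ b ∈ S, φ b ≤ φ a + inner ℝ (G a) (b - a) + rho / 2 * ‖b - a‖ ^ 2)
    {a b u : E} (ha : a ∈ S) (hb : b ∈ S) (hp : (1 / 2 : ℝ) • (a + b) + u ∈ S)
    (hq : (1 / 2 : ℝ) • (a + b) - u ∈ S) :
    2 * inner ℝ (G b - G a - (rho / 2) • (b - a)) u ≤
      rho / 2 * (‖b - a‖ ^ 2 / 2 + 2 * ‖u‖ ^ 2) := by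
  have h1 := hup a ha _ hp
  have h2 := hlow b hb _ hp
  have h3 := hup b hb _ hq
  have h4 := hlow a ha _ hq
  have e1 : (1 / 2 : ℝ) • (a + b) + u - a = (1 / 2 : ℝ) • (b - a) + u := by module
  have e2 : (1 / 2 : ℝ) • (a + b) + u - b = -(1 / 2 : ℝ) • (b - a) + u := by module
  have e3 : (1 / 2 : ℝ) • (a + b) - u - b = -(1 / 2 : ℝ) • (b - a) - u := by module
  have e4 : (1 / 2 : ℝ) • (a + b) - u - a = (1 / 2 : ℝ) • (b - a) - u := by module
  rw [e1] at h1; rw [e2] at h2; rw [e3] at h3; rw [e4] at h4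
  generalize φ ((1 / 2 : ℝ) • (a + b) + u) = fp at h1 h2
  generalize φ ((1 / 2 : ℝ) • (a + b) - u) = fq at h3 h4
  rw [norm_add_sq_real] at h1
  rw [norm_sub_sq_real] at h3
  simp only [inner_add_right, inner_sub_right, inner_smul_right, inner_sub_left,
    real_inner_smul_left, norm_smul, mul_pow, norm_neg, Real.norm_eq_abs,
    sq_abs] at h1 h2 h3 h4 ⊢
  norm_num at h1 h3
  nlinarith

/-- The optimal length of `u` in `four_point_inner_le` may leave `S`. Cutting the segment into short
pieces makes the required shift as small as desired, and both sides add up along the pieces. -/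
theorem inner_le_of_shift_mem (hS : Convex ℝ S)
    (hlow : ∀ a ∈ S, ∀ b ∈ S, φ a + inner ℝ (G a) (b - a) ≤ φ b)
    (hup : ∀ a ∈ S, ∀ b ∈ S, φ b ≤ φ a + inner ℝ (G a) (b - a) + rho / 2 * ‖b - a‖ ^ 2)
    {a b u : E} (hu : u ≠ 0)
    (hap : a + u ∈ S) (ham : a - u ∈ S) (hbp : b + u ∈ S) (hbm : b - u ∈ S) :
    inner ℝ (G b - G a - (rho / 2) • (b - a)) u ≤ rho / 2 * ‖b - a‖ * ‖u‖ := by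
  have hu' : 0 < ‖u‖ := norm_pos_iff.2 hu
  rcases eq_or_ne a b with rfl | hab
  · simp
  have hv : 0 < ‖b - a‖ := norm_pos_iff.2 (sub_ne_zero.2 hab.symm)
  obtain ⟨n, hn⟩ := exists_nat_gt (‖b - a‖ / ‖u‖)
  have hn0 : (0 : ℝ) < n := lt_trans (by positivity) hn
  let pnt : ℕ → E := fun i => a + ((i : ℝ) / n) • (b - a)
  have hpt : ∀ r : ℝ, 0 ≤ r → r ≤ 1 → ∀ k : ℝ, |k| ≤ 1 → a + r • (b - a) + k • u ∈ S := by
    intro r h0 h1 k hk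
    have hP : a + r • (b - a) + u ∈ S := by
      have := add_smul_sub_mem_of_convex hS hap hbp h0 h1
      rw [add_sub_add_right_eq_sub] at this
      convert this using 1; abel
    have hM : a + r • (b - a) - u ∈ S := by
      have := add_smul_sub_mem_of_convex hS ham hbm h0 h1
      rw [sub_sub_sub_cancel_right] at this
      convert this using 1; abel
    have := add_smul_sub_mem_of_convex hS hM hP (s := (1 + k) / 2)
      (by linarith [(abs_le.1 hk).1]) (by linarith [(abs_le.1 hk).2])
    convert this using 1
    module
  have hdiff : ∀ i, pnt (i + 1) - pnt i = (1 / (n : ℝ)) • (b - a) := by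
    intro i
    simp only [pnt]
    rw [add_sub_add_left_eq_sub, ← sub_smul]
    congr 1; push_cast; ring
  have hstep : ∀ i < n, inner ℝ (G (pnt (i + 1)) - G (pnt i)
      - (rho / 2) • (pnt (i + 1) - pnt i)) u ≤ rho / 2 * (‖b - a‖ / n) * ‖u‖ := by
    intro i hi
    have hi1 : ((i : ℝ) + 1) / n ≤ 1 := by
      rw [div_le_one hn0]; exact_mod_cast hi
    have hi0 : (i : ℝ) / n ≤ 1 := by
      rw [div_le_one hn0]; exact_mod_cast hi.le
    -- Makes `k • u` half as long as one piece, the optimal choice; `n > ‖b - a‖ / ‖u‖` keeps `k ≤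
    -- 1`.
    let k : ℝ := ‖b - a‖ / (2 * n * ‖u‖)
    have hk0 : 0 < k := by positivity
    have hk1 : |k| ≤ 1 := by
      rw [abs_of_pos hk0, div_le_one (by positivity)]
      rw [div_lt_iff₀ hu'] at hn
      nlinarith
    have hku : ‖k • u‖ = ‖b - a‖ / n / 2 := by
      rw [norm_smul, Real.norm_eq_abs, abs_of_pos hk0]; simp only [k]; field_simp
    have hmid : (1 / 2 : ℝ) • (pnt i + pnt (i + 1))
        = a + (((i : ℝ) + 1 / 2) / n) • (b - a) := by
      simp only [pnt]; push_cast
      module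
    have hm1 : ((i : ℝ) + 1 / 2) / n ≤ 1 := le_trans (by gcongr; norm_num) hi1
    have h := four_point_inner_le (S := S) (u := k • u) (a := pnt i) (b := pnt (i + 1)) hlow hup
      (by simpa using hpt _ (by positivity) hi0 0 (by simp))
      (by simpa [pnt] using hpt _ (by positivity) hi1 0 (by simp))
      (by rw [hmid]; exact hpt _ (by positivity) hm1 k hk1)
      (by rw [hmid, sub_eq_add_neg, ← neg_smul]
          exact hpt _ (by positivity) hm1 _ (by rwa [abs_neg]))
    rw [hku, inner_smul_right] at h
    have hd : ‖pnt (i + 1) - pnt i‖ = ‖b - a‖ / n := by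
      rw [hdiff, norm_smul, Real.norm_eq_abs, abs_of_pos (by positivity)]; ring
    rw [hd] at h
    have h5 : k * inner ℝ (G (pnt (i + 1)) - G (pnt i) - (rho / 2) • (pnt (i + 1) - pnt i)) u
        ≤ k * (rho / 2 * (‖b - a‖ / n) * ‖u‖) := by
      have e : k * (rho / 2 * (‖b - a‖ / n) * ‖u‖) = rho / 2 * (‖b - a‖ / n) * (‖k • u‖) := by
        rw [norm_smul, Real.norm_eq_abs, abs_of_pos hk0]; ring
      rw [e, hku]
      linarith
    exact le_of_mul_le_mul_left h5 hk0
  have hsum := Finset.sum_le_sum fun i hi => hstep i (Finset.mem_range.1 hi)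
  rw [← sum_inner, Finset.sum_sub_distrib, ← Finset.smul_sum, Finset.sum_range_sub pnt,
    Finset.sum_range_sub fun i => G (pnt i), Finset.sum_const, Finset.card_range,
    nsmul_eq_mul] at hsum
  have e0 : pnt 0 = a := by simp [pnt]
  have e1 : pnt n = b := by simp [pnt, div_self hn0.ne']
  rw [e0, e1] at hsum
  refine hsum.trans_eq ?_
  field_simp

/-- Cocoercivity of the gradient of a smooth convex function, tested on directions of its domain. -/
theorem inner_sub_smul_le_of_convex_smooth (hS : Convex ℝ S) (hrho : 0 ≤ rho) {K : ℝ}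
    (hlow : ∀ a ∈ S, ∀ b ∈ S, φ a + inner ℝ (G a) (b - a) ≤ φ b)
    (hup : ∀ a ∈ S, ∀ b ∈ S, φ b ≤ φ a + inner ℝ (G a) (b - a) + rho / 2 * ‖b - a‖ ^ 2)
    (hG : ∀ a ∈ S, ∀ b ∈ S, ‖G a - G b‖ ≤ K * ‖a - b‖)
    {a b c c' : E} (ha : a ∈ S) (hb : b ∈ S) (hc : c ∈ S) (hc' : c' ∈ S) :
    inner ℝ (G b - G a - (rho / 2) • (b - a)) (c - c') ≤ rho / 2 * ‖b - a‖ * ‖c - c'‖ := by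
  rcases eq_or_ne c c' with rfl | hcc
  · simp
  -- Moving `a` and `b` slightly towards the midpoint of `c` and `c'` creates room in the directions
  -- `± (c - c')`. The displacement is removed by `ε → 0`, using that `G` is Lipschitz.
  let m : E := (1 / 2 : ℝ) • (c + c')
  have hm : ∀ w ∈ S, ∀ ε : ℝ, 0 < ε → ε ≤ 1 →
      w + ε • (m - w) + (ε / 2) • (c - c') ∈ S ∧ w + ε • (m - w) - (ε / 2) • (c - c') ∈ S := by
    intro w hw ε h0 h1
    constructor
    · convert add_smul_sub_mem_of_convex hS hw hc h0.le h1 using 1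
      simp only [m]; module
    · convert add_smul_sub_mem_of_convex hS hw hc' h0.le h1 using 1
      simp only [m]; module
  have hmS : m ∈ S := by
    convert add_smul_sub_mem_of_convex hS hc hc' (s := 1 / 2) (by norm_num) (by norm_num) using 1
    simp only [m]; module
  refine le_of_forall_le_add_mul (C := (K * ‖m - b‖ + K * ‖m - a‖) * ‖c - c'‖) fun ε h0 h1 => ?_
  have key := inner_le_of_shift_mem hS hlow hup (a := a + ε • (m - a))
    (b := b + ε • (m - b)) (u := (ε / 2) • (c - c'))
    (smul_ne_zero (by positivity) (sub_ne_zero.2 hcc)) (hm a ha ε h0 h1).1 (hm a ha ε h0 h1).2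
    (hm b hb ε h0 h1).1 (hm b hb ε h0 h1).2
  have ea : b + ε • (m - b) - (a + ε • (m - a)) = (1 - ε) • (b - a) := by module
  rw [ea, inner_smul_right, norm_smul, norm_smul, Real.norm_eq_abs, Real.norm_eq_abs,
    abs_of_nonneg (sub_nonneg.2 h1), abs_of_pos (half_pos h0)] at key
  have key2 : ε / 2 * inner ℝ (G (b + ε • (m - b)) - G (a + ε • (m - a))
      - (rho / 2) • (1 - ε) • (b - a)) (c - c')
      ≤ ε / 2 * (rho / 2 * ((1 - ε) * ‖b - a‖) * ‖c - c'‖) := by linarith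
  have key3 := le_of_mul_le_mul_left key2 (half_pos h0)
  have lip : ∀ w ∈ S, ‖G (w + ε • (m - w)) - G w‖ ≤ ε * (K * ‖m - w‖) := by
    intro w hw
    have := hG _ (add_smul_sub_mem_of_convex hS hw hmS h0.le h1) w hw
    rw [add_sub_cancel_left, norm_smul, Real.norm_eq_abs, abs_of_pos h0] at this
    linarith
  have hbb := (neg_le_of_abs_le (abs_real_inner_le_norm (G (b + ε • (m - b)) - G b) (c - c')))
  have haa := (le_of_abs_le (abs_real_inner_le_norm (G (a + ε • (m - a)) - G a) (c - c')))
  have hbb' := mul_le_mul_of_nonneg_right (lip b hb) (norm_nonneg (c - c'))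
  have haa' := mul_le_mul_of_nonneg_right (lip a ha) (norm_nonneg (c - c'))
  have hin := (neg_le_of_abs_le (abs_real_inner_le_norm (b - a) (c - c')))
  have hin' : ε * (rho / 2) * (-(‖b - a‖ * ‖c - c'‖)) ≤ ε * (rho / 2) * inner ℝ (b - a) (c - c') := by
    gcongr
  simp only [inner_sub_left, real_inner_smul_left] at key3 hbb haa hin' ⊢
  nlinarith

end Cocoercive

end Generic

/-- Lagrange multipliers for one convex constraint under Slater's condition. -/
theorem exists_multiplier {E : Type*} [AddCommGroup E] [Module ℝ E] {S : Set E} {f h : E → ℝ}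
    (hf : ConvexOn ℝ S f) (hh : ConvexOn ℝ S h) {v delta M : ℝ} (hdelta : 0 < delta)
    (hv : ∀ z ∈ S, h z ≤ 0 → v ≤ f z) {zs : E} (hzs : zs ∈ S) (hs : h zs ≤ -delta)
    (hM : f zs - v ≤ M) :
    ∃ l, 0 ≤ l ∧ l ≤ M / delta ∧ ∀ z ∈ S, v ≤ f z + l * h z := by
  have cross : ∀ z ∈ S, ∀ w ∈ S, h z < 0 → 0 < h w → (v - f w) / h w ≤ (f z - v) / (- h z) := by
    intro z hz w hw h1 h2
    have hd : 0 < h w - h z := by linarith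
    -- These weights make the interpolated value of `h` exactly zero, so the convex combination is
    -- feasible.
    have ha : 0 ≤ h w / (h w - h z) := by positivity
    have hb : 0 ≤ -h z / (h w - h z) := div_nonneg (by linarith) hd.le
    have hab : h w / (h w - h z) + -h z / (h w - h z) = 1 := by field_simp; ring
    have c1 := hh.2 hz hw ha hb hab
    have c2 := hf.2 hz hw ha hb hab
    have c3 := hv _ (hf.1 hz hw ha hb hab) (c1.trans_eq (by simp only [smul_eq_mul]; ring))
    have c4 := c3.trans c2
    simp only [smul_eq_mul] at c4
    have e : h w / (h w - h z) * f z + -h z / (h w - h z) * f w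
        = (h w * f z - h z * f w) / (h w - h z) := by ring
    rw [e, le_div_iff₀ hd] at c4
    rw [div_le_div_iff₀ h2 (by linarith)]
    nlinarith
  have hM0 : 0 ≤ M := le_trans (sub_nonneg.2 (hv zs hzs (by linarith))) hM
  -- The multiplier is the supremum of the slopes forced by infeasible points; each strictly
  -- feasible point bounds it above. Inserting `0` gives the sign and covers the case of no
  -- infeasible point.
  let A : Set ℝ := insert 0 ((fun w => (v - f w) / h w) '' {w | w ∈ S ∧ 0 < h w})
  have hA : ∀ z ∈ S, h z < 0 → (f z - v) / (- h z) ∈ upperBounds A := by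
    rintro z hz h1 _ (rfl | ⟨w, ⟨hw, h2⟩, rfl⟩)
    · exact div_nonneg (sub_nonneg.2 (hv z hz h1.le)) (by linarith)
    · exact cross z hz w hw h1 h2
  have hzs' : h zs < 0 := by linarith
  have hbdd : BddAbove A := ⟨_, hA zs hzs hzs'⟩
  have hne : A.Nonempty := ⟨0, Set.mem_insert _ _⟩
  refine ⟨sSup A, le_csSup hbdd (Set.mem_insert _ _), ?_, ?_⟩
  · refine (csSup_le hne (hA zs hzs hzs')).trans ?_
    exact div_le_div₀ hM0 hM hdelta (by linarith)
  · intro z hz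
    rcases lt_trichotomy (h z) 0 with h1 | h1 | h1
    · have := csSup_le hne (hA z hz h1)
      rw [le_div_iff₀ (by linarith)] at this
      linarith
    · rw [h1, mul_zero, add_zero]
      exact hv z hz h1.le
    · have : (v - f z) / h z ≤ sSup A :=
        le_csSup hbdd (Set.mem_insert_of_mem _ ⟨z, ⟨hz, h1⟩, rfl⟩)
      rw [div_le_iff₀ h1] at this
      linarith

/-! ### Elementary bounds on the data -/

namespace Problem

variable {p d : ℕ} {P : Problem p d} {rhoF rhoG mu : ℝ}

/-- The minimizer of the regularized inner objective. -/
noncomputable def yStar (P : Problem p d) (x : EuclideanSpace ℝ (Fin p)) : EuclideanSpace ℝ (Fin d) :=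
  Classical.epsilon fun y => y ∈ P.Y ∧ ∀ y' ∈ P.Y, P.gReg x y ≤ P.gReg x y'

/-- The gradient of the relaxed constraint function. -/
noncomputable def gradH (P : Problem p d) (z : Pt p d) : Pt p d := P.gradHHat z (P.yStar z.fst)

theorem pt_mem_Z {x : EuclideanSpace ℝ (Fin p)} {y : EuclideanSpace ℝ (Fin d)} (hx : x ∈ P.X)
    (hy : y ∈ P.Y) : pt x y ∈ P.Z := ⟨hx, hy⟩

theorem pt_sub_pt (x x' : EuclideanSpace ℝ (Fin p)) (y y' : EuclideanSpace ℝ (Fin d)) :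
    pt x y - pt x' y' = pt (x - x') (y - y') := rfl

theorem inner_pt (v : Pt p d) (x : EuclideanSpace ℝ (Fin p)) (y : EuclideanSpace ℝ (Fin d)) :
    inner ℝ v (pt x y) = inner ℝ v.fst x + inner ℝ v.snd y := rfl

theorem norm_pt_sq (x : EuclideanSpace ℝ (Fin p)) (y : EuclideanSpace ℝ (Fin d)) :
    ‖pt x y‖ ^ 2 = ‖x‖ ^ 2 + ‖y‖ ^ 2 := WithLp.prod_norm_sq_eq_of_L2 _

theorem norm_pt_zero_left (y : EuclideanSpace ℝ (Fin d)) : ‖(pt 0 y : Pt p d)‖ = ‖y‖ := by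
  rw [← sq_eq_sq₀ (norm_nonneg _) (norm_nonneg _), norm_pt_sq]
  simp

theorem norm_pt_zero_right (x : EuclideanSpace ℝ (Fin p)) : ‖(pt x 0 : Pt p d)‖ = ‖x‖ := by
  rw [← sq_eq_sq₀ (norm_nonneg _) (norm_nonneg _), norm_pt_sq]
  simp

theorem Standing.Z_convex (hP : P.Standing) : Convex ℝ P.Z := fun _ ha _ hb _ _ hs ht hst =>
  ⟨hP.X_convex ha.1 hb.1 hs ht hst, hP.Y_convex ha.2 hb.2 hs ht hst⟩

theorem Standing.Y_compact (hP : P.Standing) : IsCompact P.Y :=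
  Metric.isCompact_of_isClosed_isBounded hP.Y_closed hP.Y_bounded

theorem Standing.Z_compact (hP : P.Standing) : IsCompact P.Z := by
  have hX : IsCompact P.X := Metric.isCompact_of_isClosed_isBounded hP.X_closed hP.X_bounded
  have h := (hX.prod hP.Y_compact).image (WithLp.prod_continuous_toLp 2 _ _)
  convert h using 1
  ext z
  exact ⟨fun hz => ⟨(z.fst, z.snd), ⟨hz.1, hz.2⟩, rfl⟩, by rintro ⟨w, hw, rfl⟩; exact ⟨hw.1, hw.2⟩⟩

theorem Standing.Z_nonempty (hP : P.Standing) : P.Z.Nonempty := by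
  obtain ⟨x, hx⟩ := hP.X_nonempty
  obtain ⟨y, hy⟩ := hP.Y_nonempty
  exact ⟨pt x y, hx, hy⟩

theorem Standing.norm_sub_le_DZ (hP : P.Standing) {a b : Pt p d} (ha : a ∈ P.Z) (hb : b ∈ P.Z) :
    ‖a - b‖ ≤ P.DZ := by
  rw [← dist_eq_norm]
  exact Metric.dist_le_diam_of_mem hP.Z_compact.isBounded ha hb

theorem Standing.norm_le_RY (hP : P.Standing) {y : EuclideanSpace ℝ (Fin d)} (hy : y ∈ P.Y) :
    ‖y‖ ≤ P.RY :=
  le_csSup (hP.Y_compact.image continuous_norm).bddAbove ⟨y, hy, rfl⟩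

theorem Standing.abs_sub_le_Df (hP : P.Standing) {a b : Pt p d} (ha : a ∈ P.Z) (hb : b ∈ P.Z) :
    |P.f a - P.f b| ≤ P.Df := by
  have hc : ContinuousOn P.f P.Z := continuousOn_of_differentiableAt hP.f_diff
  obtain ⟨C, hC⟩ := hP.Z_compact.exists_bound_of_continuousOn hc
  refine le_csSup ⟨C + C, ?_⟩ ⟨a, ha, b, hb, rfl⟩
  rintro _ ⟨z, hz, z', hz', rfl⟩
  exact (abs_sub _ _).trans (add_le_add (hC z hz) (hC z' hz'))

theorem Standing.Df_nonneg (hP : P.Standing) : 0 ≤ P.Df := by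
  obtain ⟨z, hz⟩ := hP.Z_nonempty
  exact (abs_nonneg _).trans (hP.abs_sub_le_Df hz hz)

theorem GradLipschitz.f_quad (h1 : P.GradLipschitz rhoF rhoG) (hP : P.Standing)
    {a b : Pt p d} (ha : a ∈ P.Z) (hb : b ∈ P.Z) :
    |P.f b - P.f a - inner ℝ (gradient P.f a) (b - a)| ≤ rhoF / 2 * ‖b - a‖ ^ 2 :=
  abs_sub_sub_inner_le_of_lipschitz hP.Z_convex hP.f_diff h1.f_lip ha hb

theorem GradLipschitz.g_quad (h1 : P.GradLipschitz rhoF rhoG) (hP : P.Standing)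
    {a b : Pt p d} (ha : a ∈ P.Z) (hb : b ∈ P.Z) :
    |P.g b - P.g a - inner ℝ (gradient P.g a) (b - a)| ≤ rhoG / 2 * ‖b - a‖ ^ 2 :=
  abs_sub_sub_inner_le_of_lipschitz hP.Z_convex hP.g_diff h1.g_lip ha hb

theorem GradLipschitz.norm_gradient_le_Lg (h1 : P.GradLipschitz rhoF rhoG) (hP : P.Standing)
    {z : Pt p d} (hz : z ∈ P.Z) : ‖gradient P.g z‖ ≤ P.Lg := by
  refine le_csSup ⟨‖gradient P.g z‖ + rhoG * P.DZ, ?_⟩ ⟨z, hz, rfl⟩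
  rintro _ ⟨w, hw, rfl⟩
  have h2 := h1.g_lip w hw z hz
  have h3 := mul_le_mul_of_nonneg_left (hP.norm_sub_le_DZ hw hz) h1.rhoG_nonneg
  have h4 := norm_le_norm_add_norm_sub (gradient P.g z) (gradient P.g w)
  rw [norm_sub_rev] at h4
  dsimp only
  linarith

theorem GradLipschitz.norm_gradX_le_Lg (h1 : P.GradLipschitz rhoF rhoG) (hP : P.Standing)
    {z : Pt p d} (hz : z ∈ P.Z) : ‖P.gradX z‖ ≤ P.Lg :=
  (WithLp.norm_fst_le _ _).trans (h1.norm_gradient_le_Lg hP hz)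

theorem GradLipschitz.norm_gradY_le_Lg (h1 : P.GradLipschitz rhoF rhoG) (hP : P.Standing)
    {z : Pt p d} (hz : z ∈ P.Z) : ‖P.gradY z‖ ≤ P.Lg :=
  (WithLp.norm_snd_le _ _).trans (h1.norm_gradient_le_Lg hP hz)

/-! ### The regularized inner problem and its value function -/

section Inner

variable {x x' : EuclideanSpace ℝ (Fin p)} {y y' : EuclideanSpace ℝ (Fin d)}

theorem Standing.yStar_spec (hP : P.Standing) (hx : x ∈ P.X) :
    P.yStar x ∈ P.Y ∧ ∀ y' ∈ P.Y, P.gReg x (P.yStar x) ≤ P.gReg x y' := by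
  have hg : ContinuousOn P.g P.Z := continuousOn_of_differentiableAt hP.g_diff
  have hpt : Continuous fun y : EuclideanSpace ℝ (Fin d) => pt x y :=
    (WithLp.prod_continuous_toLp 2 _ _).comp (by fun_prop)
  have hc : ContinuousOn (P.gReg x) P.Y :=
    (hg.comp hpt.continuousOn fun y hy => pt_mem_Z hx hy).add (by fun_prop)
  obtain ⟨y, hy, hmin⟩ := hP.Y_compact.exists_isMinOn hP.Y_nonempty hc
  have hex : ∃ y, y ∈ P.Y ∧ ∀ y' ∈ P.Y, P.gReg x y ≤ P.gReg x y' := ⟨y, hy, fun y' hy' => hmin hy'⟩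
  exact Classical.epsilon_spec hex

theorem Standing.gStar_eq (hP : P.Standing) (hx : x ∈ P.X) :
    P.gStar x = P.gReg x (P.yStar x) := by
  obtain ⟨h1, h2⟩ := hP.yStar_spec hx
  refine IsLeast.csInf_eq ⟨⟨_, h1, rfl⟩, ?_⟩
  rintro _ ⟨y, hy, rfl⟩
  exact h2 y hy

theorem Standing.gStar_le (hP : P.Standing) (hx : x ∈ P.X) (hy : y ∈ P.Y) :
    P.gStar x ≤ P.gReg x y := by
  rw [hP.gStar_eq hx]
  exact (hP.yStar_spec hx).2 y hy

theorem GradLipschitz.g_upper_snd (h1 : P.GradLipschitz rhoF rhoG) (hP : P.Standing)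
    (hx : x ∈ P.X) (hy : y ∈ P.Y) (hy' : y' ∈ P.Y) :
    P.g (pt x y') ≤ P.g (pt x y) + inner ℝ (P.gradY (pt x y)) (y' - y)
      + rhoG / 2 * ‖y' - y‖ ^ 2 := by
  have h := (abs_le.1 (h1.g_quad hP (pt_mem_Z hx hy) (pt_mem_Z hx hy'))).2
  rw [pt_sub_pt, sub_self, inner_pt, norm_pt_zero_left, inner_zero_right] at h
  simp only [gradY]
  linarith

theorem GradLipschitz.g_upper_fst (h1 : P.GradLipschitz rhoF rhoG) (hP : P.Standing)
    (hx : x ∈ P.X) (hx' : x' ∈ P.X) (hy : y ∈ P.Y) :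
    P.g (pt x' y) ≤ P.g (pt x y) + inner ℝ (P.gradX (pt x y)) (x' - x)
      + rhoG / 2 * ‖x' - x‖ ^ 2 := by
  have h := (abs_le.1 (h1.g_quad hP (pt_mem_Z hx hy) (pt_mem_Z hx' hy))).2
  rw [pt_sub_pt, sub_self, inner_pt, norm_pt_zero_right, inner_zero_right] at h
  simp only [gradX]
  linarith

theorem GradLipschitz.g_lower_snd (h1 : P.GradLipschitz rhoF rhoG)
    (hx : x ∈ P.X) (hy : y ∈ P.Y) (hy' : y' ∈ P.Y) :
    P.g (pt x y) + inner ℝ (P.gradY (pt x y)) (y' - y) ≤ P.g (pt x y') := by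
  have h := h1.g_lower x hx x hx y hy y' hy'
  simpa using h

theorem norm_sq_expand {E : Type*} [NormedAddCommGroup E] [InnerProductSpace ℝ E] (a b : E) :
    ‖b‖ ^ 2 = ‖a‖ ^ 2 + 2 * inner ℝ a (b - a) + ‖b - a‖ ^ 2 := by
  rw [← norm_add_sq_real, add_sub_cancel]

theorem GradLipschitz.inner_yStar_nonneg (h1 : P.GradLipschitz rhoF rhoG) (hP : P.Standing)
    (hx : x ∈ P.X) (hy : y ∈ P.Y) :
    0 ≤ inner ℝ (P.gradY (pt x (P.yStar x)) + P.alpha • P.yStar x) (y - P.yStar x) := by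
  obtain ⟨hs, hmin⟩ := hP.yStar_spec hx
  refine le_of_forall_le_add_mul (C := (rhoG + P.alpha) / 2 * ‖y - P.yStar x‖ ^ 2)
    fun s h0 h2 => ?_
  have hm := add_smul_sub_mem_of_convex hP.Y_convex hs hy h0.le h2
  have h3 := hmin _ hm
  have h4 := h1.g_upper_snd hP hx hs hm
  simp only [gReg] at h3
  rw [norm_sq_expand (P.yStar x) (P.yStar x + s • (y - P.yStar x))] at h3
  rw [add_sub_cancel_left, inner_smul_right, norm_smul, mul_pow, Real.norm_eq_abs, sq_abs] at h3 h4
  rw [inner_add_left, real_inner_smul_left]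
  refine le_of_mul_le_mul_left ?_ h0
  nlinarith

theorem GradLipschitz.gReg_sub_le (h1 : P.GradLipschitz rhoF rhoG) (hP : P.Standing)
    (hx : x ∈ P.X) (hy : y ∈ P.Y) (hy' : y' ∈ P.Y) :
    P.gReg x y - P.gReg x y' ≤ (P.Lg + P.alpha * P.RY) * ‖y - y'‖ := by
  have h2 := h1.g_lower_snd hx hy hy'
  have h3 := norm_sq_expand y y'
  have h4 := mul_nonneg hP.alpha_pos.le (sq_nonneg ‖y' - y‖)
  have h5 := real_inner_le_norm (P.gradY (pt x y) + P.alpha • y) (y - y')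
  have h6 : ‖P.gradY (pt x y) + P.alpha • y‖ ≤ P.Lg + P.alpha * P.RY := by
    refine (norm_add_le _ _).trans (add_le_add (h1.norm_gradY_le_Lg hP (pt_mem_Z hx hy)) ?_)
    rw [norm_smul, Real.norm_eq_abs, abs_of_pos hP.alpha_pos]
    exact mul_le_mul_of_nonneg_left (hP.norm_le_RY hy) hP.alpha_pos.le
  have h7 := mul_le_mul_of_nonneg_right h6 (norm_nonneg (y - y'))
  simp only [gReg]
  rw [← neg_sub y y', inner_neg_right, norm_neg] at h3
  rw [← neg_sub y y', inner_neg_right] at h2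
  rw [inner_add_left, real_inner_smul_left] at h5
  rw [norm_sub_rev] at h4
  rw [h3]
  nlinarith

/-- The old minimizer `yStar x` is a competitor at `x'`. -/
theorem GradLipschitz.gStar_upper (h1 : P.GradLipschitz rhoF rhoG) (hP : P.Standing)
    (hx : x ∈ P.X) (hx' : x' ∈ P.X) :
    P.gStar x' ≤ P.gStar x + inner ℝ (P.gradX (pt x (P.yStar x))) (x' - x)
      + rhoG / 2 * ‖x' - x‖ ^ 2 := by
  have hs := (hP.yStar_spec hx).1
  have h2 := hP.gStar_le hx' hs
  have h3 := h1.g_upper_fst hP hx hx' hs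
  rw [hP.gStar_eq hx]
  simp only [gReg] at h2 ⊢
  linarith

/-- Apply `g_lower` between the two minimizers. The variational inequality at `yStar x` removes the
terms in `y`, so the error involves `x` alone and no Lipschitz bound on `yStar` is needed. -/
theorem GradLipschitz.gStar_lower (h1 : P.GradLipschitz rhoF rhoG) (hP : P.Standing)
    (hx : x ∈ P.X) (hx' : x' ∈ P.X) :
    P.gStar x + inner ℝ (P.gradX (pt x (P.yStar x))) (x' - x) - rhoG / 2 * ‖x' - x‖ ^ 2
      ≤ P.gStar x' := by
  have hs := (hP.yStar_spec hx).1
  have hs' := (hP.yStar_spec hx').1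
  have h2 := h1.g_lower x hx x' hx' _ hs _ hs'
  have h3 := h1.inner_yStar_nonneg hP hx hs'
  have h4 := norm_sq_expand (P.yStar x) (P.yStar x')
  have h5 := mul_nonneg hP.alpha_pos.le (sq_nonneg ‖P.yStar x' - P.yStar x‖)
  rw [inner_add_left, real_inner_smul_left] at h3
  rw [hP.gStar_eq hx, hP.gStar_eq hx']
  simp only [gReg] at h2 ⊢
  rw [norm_sub_rev] at h2
  rw [h4]
  nlinarith

end Inner

/-! ### First-order behaviour of the relaxed constraint -/

theorem norm_fst_sub_sq_le (a b : Pt p d) : ‖b.fst - a.fst‖ ^ 2 ≤ ‖b - a‖ ^ 2 := by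
  gcongr
  exact WithLp.norm_fst_le _ (b - a)

theorem inner_gradHHat (a v : Pt p d) (y : EuclideanSpace ℝ (Fin d)) :
    inner ℝ (P.gradHHat a y) v
      = inner ℝ (gradient P.g a) v - inner ℝ (P.gradX (pt a.fst y)) v.fst := by
  have : inner ℝ (pt (P.gradX (pt a.fst y)) 0 : Pt p d) v = inner ℝ (P.gradX (pt a.fst y)) v.fst := by
    rw [real_inner_comm, inner_pt, inner_zero_right, add_zero, real_inner_comm]
  rw [gradHHat, inner_sub_left, this]

/-- The functions `g` and `gStar` each contribute `rhoG / 2`. -/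
theorem GradLipschitz.abs_h_sub_sub_inner_le (h1 : P.GradLipschitz rhoF rhoG) (hP : P.Standing)
    {a b : Pt p d} (ha : a ∈ P.Z) (hb : b ∈ P.Z) :
    |P.h b - P.h a - inner ℝ (P.gradH a) (b - a)| ≤ rhoG * ‖b - a‖ ^ 2 := by
  have h2 := abs_le.1 (h1.g_quad hP ha hb)
  have h3 := h1.gStar_upper hP ha.1 hb.1
  have h4 := h1.gStar_lower hP ha.1 hb.1
  have h5 := mul_le_mul_of_nonneg_left (norm_fst_sub_sq_le a b) h1.rhoG_nonneg
  rw [gradH, inner_gradHHat, WithLp.sub_fst]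
  simp only [h]
  rw [abs_le]
  constructor <;> linarith [h2.1, h2.2]

theorem GradLipschitz.norm_gradH_le (h1 : P.GradLipschitz rhoF rhoG) (hP : P.Standing)
    {z : Pt p d} (hz : z ∈ P.Z) : ‖P.gradH z‖ ≤ 2 * P.Lg := by
  refine (norm_sub_le _ _).trans ?_
  rw [norm_pt_zero_right]
  linarith [h1.norm_gradient_le_Lg hP hz,
    h1.norm_gradX_le_Lg hP (pt_mem_Z hz.1 (hP.yStar_spec hz.1).1)]

/-- For a convex function a linearization that is valid up to a quadratic error is an exact lower
bound, so `gradH` is a subgradient relative to `Z`. -/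
theorem StrongConvexity.add_inner_gradH_le (h2 : P.StrongConvexity mu)
    (h1 : P.GradLipschitz rhoF rhoG) (hP : P.Standing) {a b : Pt p d} (ha : a ∈ P.Z)
    (hb : b ∈ P.Z) : P.h a + inner ℝ (P.gradH a) (b - a) ≤ P.h b := by
  have := StrongConvexOn.add_inner_le (strongConvexOn_zero.2 h2.h_convex) (C := rhoG) ha hb
    fun w hw => by linarith [(abs_le.1 (h1.abs_h_sub_sub_inner_le hP ha hw)).1]
  linarith

theorem StrongConvexity.f_lower (h2 : P.StrongConvexity mu)
    (h1 : P.GradLipschitz rhoF rhoG) (hP : P.Standing) {a b : Pt p d} (ha : a ∈ P.Z)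
    (hb : b ∈ P.Z) :
    P.f a + inner ℝ (gradient P.f a) (b - a) + mu / 2 * ‖b - a‖ ^ 2 ≤ P.f b :=
  StrongConvexOn.add_inner_le h2.f_strong (C := rhoF / 2) ha hb
    fun w hw => by linarith [(abs_le.1 (h1.f_quad hP ha hw)).1]

theorem StrongConvexity.abs_h_sub_le (h2 : P.StrongConvexity mu)
    (h1 : P.GradLipschitz rhoF rhoG) (hP : P.Standing) {a b : Pt p d} (ha : a ∈ P.Z)
    (hb : b ∈ P.Z) : |P.h a - P.h b| ≤ 2 * P.Lg * ‖a - b‖ := by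
  have key : ∀ a ∈ P.Z, ∀ b ∈ P.Z, P.h a - P.h b ≤ 2 * P.Lg * ‖a - b‖ := by
    intro a ha b hb
    have h3 := h2.add_inner_gradH_le h1 hP ha hb
    have h4 := real_inner_le_norm (P.gradH a) (a - b)
    have h5 := mul_le_mul_of_nonneg_right (h1.norm_gradH_le hP ha) (norm_nonneg (a - b))
    rw [← neg_sub a b, inner_neg_right] at h3
    linarith
  rw [abs_le]
  have := key b hb a ha
  rw [norm_sub_rev] at this
  exact ⟨by linarith, key a ha b hb⟩

/-- Slater's condition: `gStar` exceeds `g` at the minimizer by the regularization term, which is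
nonnegative. -/
theorem Standing.h_yStar_le (hP : P.Standing) {x : EuclideanSpace ℝ (Fin p)} (hx : x ∈ P.X) :
    P.h (pt x (P.yStar x)) ≤ - P.delta := by
  have e : P.h (pt x (P.yStar x)) = P.g (pt x (P.yStar x)) - P.gStar x - P.delta := rfl
  rw [e, hP.gStar_eq hx, gReg]
  have := mul_nonneg hP.alpha_pos.le (sq_nonneg ‖P.yStar x‖)
  linarith

/-! ### Linear convergence of the inner iteration -/

theorem GradLipschitz.inner_gradY_sub_smul_le (h1 : P.GradLipschitz rhoF rhoG) (hP : P.Standing)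
    {x : EuclideanSpace ℝ (Fin p)} (hx : x ∈ P.X) {a b c c' : EuclideanSpace ℝ (Fin d)}
    (ha : a ∈ P.Y) (hb : b ∈ P.Y) (hc : c ∈ P.Y) (hc' : c' ∈ P.Y) :
    inner ℝ (P.gradY (pt x b) - P.gradY (pt x a) - (rhoG / 2) • (b - a)) (c - c')
      ≤ rhoG / 2 * ‖b - a‖ * ‖c - c'‖ := by
  refine inner_sub_smul_le_of_convex_smooth (K := rhoG) (φ := fun y => P.g (pt x y))
    (G := fun y => P.gradY (pt x y)) hP.Y_convex h1.rhoG_nonneg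
    (fun a ha b hb => h1.g_lower_snd hx ha hb) (fun a ha b hb => h1.g_upper_snd hP hx ha hb)
    (fun a ha b hb => ?_) ha hb hc hc'
  have := h1.g_lip _ (pt_mem_Z hx ha) _ (pt_mem_Z hx hb)
  rw [pt_sub_pt, sub_self, norm_pt_zero_left] at this
  exact (WithLp.norm_snd_le _ (gradient P.g (pt x a) - gradient P.g (pt x b))).trans this

theorem Standing.proj_Y (hP : P.Standing) (u : EuclideanSpace ℝ (Fin d)) : proj P.Y u ∈ P.Y :=
  (proj_mem_and_le hP.Y_nonempty hP.Y_closed.isComplete hP.Y_convex u).1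

theorem Standing.innerIter_mem (hP : P.Standing) (x : EuclideanSpace ℝ (Fin p))
    {y0 : EuclideanSpace ℝ (Fin d)} (hy0 : y0 ∈ P.Y) :
    ∀ n, P.innerIter rhoG x y0 n ∈ P.Y
  | 0 => hy0
  | _ + 1 => hP.proj_Y _

theorem GradLipschitz.norm_proj_step_sub_yStar_le (h1 : P.GradLipschitz rhoF rhoG)
    (hP : P.Standing) {x : EuclideanSpace ℝ (Fin p)} (hx : x ∈ P.X)
    {y : EuclideanSpace ℝ (Fin d)} (hy : y ∈ P.Y) :
    ‖proj P.Y (y - (2 / (rhoG + 2 * P.alpha)) • (P.gradY (pt x y) + P.alpha • y)) - P.yStar x‖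
      ≤ rhoG / (rhoG + 2 * P.alpha) * ‖y - P.yStar x‖ := by
  have hs := (hP.yStar_spec hx).1
  have hpos : 0 < rhoG + 2 * P.alpha := by linarith [h1.rhoG_nonneg, hP.alpha_pos]
  set s := 2 / (rhoG + 2 * P.alpha) with hsdef
  have hs0 : 0 < s := by positivity
  -- The stepsize is chosen for this identity: the part of the step linear in `y - ys` is then the
  -- shift `rhoG / 2` of the cocoercivity bound.
  have hsa : 1 - s * P.alpha = s * (rhoG / 2) := by rw [hsdef]; field_simp; ring
  have hq : rhoG / (rhoG + 2 * P.alpha) = s * (rhoG / 2) := by rw [hsdef]; field_simp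
  set ys := P.yStar x
  set u := y - s • (P.gradY (pt x y) + P.alpha • y) with hu
  have hmem : proj P.Y u ∈ P.Y := hP.proj_Y u
  have v1 := inner_sub_proj_le hP.Y_nonempty hP.Y_closed.isComplete hP.Y_convex u hs
  have v2 := h1.inner_yStar_nonneg hP hx hmem
  have v3 := h1.inner_gradY_sub_smul_le hP hx hs hy hs hmem
  set q := proj P.Y u
  rw [hq]
  have key : ‖q - ys‖ * ‖q - ys‖ ≤ s * (rhoG / 2) * ‖y - ys‖ * ‖q - ys‖ := by
    have e : ‖q - ys‖ * ‖q - ys‖ = inner ℝ (u - q) (ys - q)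
        - s * inner ℝ (P.gradY (pt x ys) + P.alpha • ys) (q - ys)
        + s * inner ℝ (P.gradY (pt x y) - P.gradY (pt x ys) - (rhoG / 2) • (y - ys)) (ys - q) := by
      have e1 : q - ys = -(ys - q) := by abel
      have e2 : u - q = (ys - q) + (1 - s * P.alpha) • (y - ys)
          - s • (P.gradY (pt x y) - P.gradY (pt x ys)) - s • (P.gradY (pt x ys) + P.alpha • ys) := by
        rw [hu]; module
      rw [e2, hsa, ← real_inner_self_eq_norm_mul_norm, e1]
      simp only [inner_sub_left, inner_add_left, real_inner_smul_left, inner_neg_right,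
        inner_neg_left]
      ring
    rw [e]
    have v2' := mul_nonneg hs0.le v2
    have v3' := mul_le_mul_of_nonneg_left v3 hs0.le
    rw [norm_sub_rev ys q] at v3'
    linarith
  rcases (norm_nonneg (q - ys)).eq_or_lt with h0 | h0
  · rw [← h0]
    have := h1.rhoG_nonneg
    positivity
  · exact le_of_mul_le_mul_right key h0

theorem GradLipschitz.norm_innerIter_sub_yStar_le (h1 : P.GradLipschitz rhoF rhoG)
    (hP : P.Standing) {x : EuclideanSpace ℝ (Fin p)} (hx : x ∈ P.X)
    {y0 : EuclideanSpace ℝ (Fin d)} (hy0 : y0 ∈ P.Y) (n : ℕ) :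
    ‖P.innerIter rhoG x y0 n - P.yStar x‖
      ≤ P.DZ * (1 - P.alpha / (rhoG + 2 * P.alpha)) ^ n := by
  have hr := h1.rhoG_nonneg
  have ha := hP.alpha_pos
  -- The contraction factor proved above is smaller than the stated rate.
  have hle : rhoG / (rhoG + 2 * P.alpha) ≤ 1 - P.alpha / (rhoG + 2 * P.alpha) := by
    rw [le_sub_iff_add_le, ← add_div, div_le_one (by positivity)]
    linarith
  have h0 : 0 ≤ rhoG / (rhoG + 2 * P.alpha) := by positivity
  induction n with
  | zero =>
    have := hP.norm_sub_le_DZ (pt_mem_Z hx hy0) (pt_mem_Z hx (hP.yStar_spec hx).1)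
    rw [pt_sub_pt, sub_self, norm_pt_zero_left] at this
    simpa [innerIter] using this
  | succ n ih =>
    refine (h1.norm_proj_step_sub_yStar_le hP hx (hP.innerIter_mem x hy0 n)).trans ?_
    calc _ ≤ (1 - P.alpha / (rhoG + 2 * P.alpha)) *
          (P.DZ * (1 - P.alpha / (rhoG + 2 * P.alpha)) ^ n) :=
          mul_le_mul hle ih (norm_nonneg _) (h0.trans hle)
      _ = _ := by ring

/-! ### Existence and uniqueness of the minimizer -/

theorem Standing.exists_unique_isSolution (hP : P.Standing) (h1 : P.GradLipschitz rhoF rhoG)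
    (h2 : P.StrongConvexity mu) : ∃! zs, P.IsSolution zs := by
  have hf : ContinuousOn P.f P.Z := continuousOn_of_differentiableAt hP.f_diff
  have hh : ContinuousOn P.h P.Z := by
    refine (LipschitzOnWith.of_dist_le_mul (K := ⟨2 * P.Lg, ?_⟩) fun a ha b hb => ?_).continuousOn
    · obtain ⟨z, hz⟩ := hP.Z_nonempty
      exact (norm_nonneg _).trans (h1.norm_gradH_le hP hz)
    · rw [Real.dist_eq, dist_eq_norm]
      exact h2.abs_h_sub_le h1 hP ha hb
  have hcpt : IsCompact {z | z ∈ P.Z ∧ P.h z ≤ 0} :=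
    hP.Z_compact.of_isClosed_subset
      (hh.preimage_isClosed_of_isClosed hP.Z_compact.isClosed isClosed_Iic) fun z hz => hz.1
  have hne : {z | z ∈ P.Z ∧ P.h z ≤ 0}.Nonempty := by
    obtain ⟨x, hx⟩ := hP.X_nonempty
    exact ⟨_, pt_mem_Z hx (hP.yStar_spec hx).1,
      (hP.h_yStar_le hx).trans (by linarith [hP.delta_pos])⟩
  obtain ⟨zs, hzs, hmin⟩ := hcpt.exists_isMinOn hne (hf.mono fun z hz => hz.1)
  refine ⟨zs, ⟨hzs.1, hzs.2, fun z hz hz' => hmin ⟨hz, hz'⟩⟩, fun w hw => ?_⟩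
  have hconv : Convex ℝ {z | z ∈ P.Z ∧ P.h z ≤ 0} := h2.h_convex.convex_le 0
  have hstrict : StrictConvexOn ℝ {z | z ∈ P.Z ∧ P.h z ≤ 0} P.f :=
    (h2.f_strong.strictConvexOn h2.mu_pos).subset (fun z hz => hz.1) hconv
  exact hstrict.eq_of_isMinOn (fun z hz => hw.2.2 z hz.1 hz.2) hmin ⟨hw.1, hw.2.1⟩ hzs

end Problem

/-! ### Weighted summation of the step inequalities -/

section Telescoping

variable {mu t0 L : ℝ}

/-- Young's inequality, weighted to charge a change of `h` partly to the dual increment and partly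
to the primal movement `D`. -/
theorem mul_le_weighted_sq (hmu : 0 < mu) {k x d D : ℝ} (hk : 0 < k)
    (hd : |d| ≤ 2 * L * D) :
    x * d ≤ 8 * L ^ 2 / (mu * k) * x ^ 2 + mu * k / 8 * D ^ 2 := by
  have h1 : x * d ≤ |x| * (2 * L * D) := by
    refine (le_abs_self _).trans ?_
    rw [abs_mul]
    gcongr
  have hmk : 0 < mu * k := by positivity
  have h2 : 0 ≤ (8 * L * |x| - mu * k * D) ^ 2 / (8 * (mu * k)) := by positivity
  have e : (8 * L * |x| - mu * k * D) ^ 2 / (8 * (mu * k))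
      = 8 * L ^ 2 / (mu * k) * |x| ^ 2 + mu * k / 8 * D ^ 2 - |x| * (2 * L * D) := by
    field_simp
    ring
  rw [e, sq_abs] at h2
  linarith

theorem sum_gammaSeq_ge (ht0 : 0 ≤ t0) (T : ℕ) :
    (T : ℝ) ^ 2 / 2 ≤ ∑ t ∈ Finset.range T, gammaSeq t0 t := by
  induction T with
  | zero => simp
  | succ n ih =>
    rw [Finset.sum_range_succ, gammaSeq]
    push_cast
    linarith

/-- Summation of the one-step primal-dual inequalities. -/
theorem sum_gammaSeq_mul_le (hmu : 0 < mu) (ht0 : 0 ≤ t0) {eps lam : ℝ}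
    {l a D dd Q : ℕ → ℝ} (ha : ∀ t, 0 ≤ a t) (hd0 : dd 0 = 0)
    (hd : ∀ t, |dd (t + 1)| ≤ 2 * L * D t)
    (hstep : ∀ t, Q t ≤ (etaSeq mu t0 t - mu) / 2 * a t - etaSeq mu t0 t / 2 * a (t + 1)
      - mu * (t + 1) / 4 * D t ^ 2 + (lam - l (t + 1)) * (dd (t + 1) - thetaSeq t0 t * dd t)
      + tauSeq mu L t / 2 * ((lam - l t) ^ 2 - (l (t + 1) - l t) ^ 2 - (lam - l (t + 1)) ^ 2)
      + eps) {T : ℕ} (hT : 1 ≤ T) :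
    ∑ t ∈ Finset.range T, gammaSeq t0 t * Q t ≤
      (gammaSeq t0 0 * tauSeq mu L 0 * (lam - l 0) ^ 2
        + gammaSeq t0 0 * (etaSeq mu t0 0 - mu) * a 0) / 2
      + (∑ t ∈ Finset.range T, gammaSeq t0 t) * eps := by
  have hg : ∀ t, 0 < gammaSeq t0 t := fun t => by rw [gammaSeq]; positivity
  -- The last four terms are carried along because the next step uses them: the pending cross term,
  -- the two distances and the primal movement.
  have key : ∀ n : ℕ, ∑ t ∈ Finset.range (n + 1), gammaSeq t0 t * Q t ≤
      (gammaSeq t0 0 * tauSeq mu L 0 * (lam - l 0) ^ 2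
        + gammaSeq t0 0 * (etaSeq mu t0 0 - mu) * a 0) / 2
      + (∑ t ∈ Finset.range (n + 1), gammaSeq t0 t) * eps
      + gammaSeq t0 n * ((lam - l (n + 1)) * dd (n + 1))
      - gammaSeq t0 n * tauSeq mu L n / 2 * (lam - l (n + 1)) ^ 2
      - gammaSeq t0 n * etaSeq mu t0 n / 2 * a (n + 1)
      - gammaSeq t0 n * (mu * (n + 1) / 4 * D n ^ 2) := by
    intro n
    induction n with
    | zero =>
      have h := mul_le_mul_of_nonneg_left (hstep 0) (hg 0).le
      have h' : 0 ≤ gammaSeq t0 0 * (tauSeq mu L 0 / 2 * (l (0 + 1) - l 0) ^ 2) := by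
        have := hg 0
        rw [tauSeq]
        positivity
      rw [hd0] at h
      simp only [Finset.sum_range_succ, Finset.sum_range_zero, zero_add] at h h' ⊢
      linarith
    | succ n ih =>
      have h := mul_le_mul_of_nonneg_left (hstep (n + 1)) (hg (n + 1)).le
      rw [Finset.sum_range_succ _ (n + 1), Finset.sum_range_succ (gammaSeq t0) (n + 1)]
      have hn : (0 : ℝ) ≤ n := Nat.cast_nonneg n
      -- With `s = γ_n` this is `(s + 1) * (s - 1) ≤ s²`; strong convexity pays for the growing
      -- weights.
      have c1 : gammaSeq t0 (n + 1) * (etaSeq mu t0 (n + 1) - mu) / 2 * a (n + 1)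
          ≤ gammaSeq t0 n * etaSeq mu t0 n / 2 * a (n + 1) := by
        refine mul_le_mul_of_nonneg_right ?_ (ha _)
        simp only [gammaSeq, etaSeq]
        push_cast
        nlinarith
      have c2 : gammaSeq t0 (n + 1) * thetaSeq t0 (n + 1) = gammaSeq t0 n := by
        simp only [gammaSeq, thetaSeq]
        push_cast
        field_simp
        ring
      have c3 : gammaSeq t0 (n + 1) * tauSeq mu L (n + 1) / 2 * (lam - l (n + 1)) ^ 2
          ≤ gammaSeq t0 n * tauSeq mu L n / 2 * (lam - l (n + 1)) ^ 2 := by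
        refine mul_le_mul_of_nonneg_right ?_ (sq_nonneg _)
        have e : ∀ k : ℕ, gammaSeq t0 k * tauSeq mu L k
            = 32 * L ^ 2 / mu * (1 + t0 / (k + 1)) := by
          intro k
          simp only [gammaSeq, tauSeq]
          field_simp
          ring
        rw [e, e]
        push_cast
        gcongr
        linarith
      have c4 : gammaSeq t0 n * ((l (n + 2) - l (n + 1)) * dd (n + 1))
          ≤ gammaSeq t0 (n + 1) * tauSeq mu L (n + 1) / 2 * (l (n + 2) - l (n + 1)) ^ 2
            + gammaSeq t0 n * (mu * (n + 1) / 4 * D n ^ 2) := by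
        have h1 := mul_le_weighted_sq (x := l (n + 2) - l (n + 1)) hmu
          (k := n + 1) (by positivity) (hd n)
        have h2 := mul_le_mul_of_nonneg_left h1 (hg n).le
        -- Besides monotonicity of `γ`, this is `n + 2 ≤ 2 * (n + 1)`; the constant 32 in `τ` leaves
        -- room for this factor.
        have h3 : gammaSeq t0 n * (8 * L ^ 2 / (mu * (n + 1)))
            ≤ gammaSeq t0 (n + 1) * (tauSeq mu L (n + 1) / 2) := by
          refine mul_le_mul ?_ ?_ (by positivity) (hg _).le
          · simp only [gammaSeq]; push_cast; linarith
          · simp only [tauSeq]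
            push_cast
            rw [div_div, div_le_div_iff₀ (by positivity) (by positivity)]
            have : 0 ≤ L ^ 2 * mu * n := by positivity
            linarith
        have h4 := mul_le_mul_of_nonneg_right h3 (sq_nonneg (l (n + 2) - l (n + 1)))
        have h5 : 0 ≤ gammaSeq t0 n * (mu * (n + 1) / 8 * D n ^ 2) := by
          have := hg n
          positivity
        linarith
      have c5 : gammaSeq t0 (n + 1) * ((lam - l (n + 2)) * (dd (n + 2)
          - thetaSeq t0 (n + 1) * dd (n + 1)))
          = gammaSeq t0 (n + 1) * ((lam - l (n + 2)) * dd (n + 2))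
            - gammaSeq t0 n * ((lam - l (n + 2)) * dd (n + 1)) := by
        rw [← c2]; ring
      simp only [show n + 1 + 1 = n + 2 from rfl] at *
      linarith
  obtain ⟨n, rfl⟩ : ∃ n, T = n + 1 := ⟨T - 1, by omega⟩
  refine (key n).trans ?_
  -- The last cross term has no successor to cancel it; the retained dual distance and primal
  -- movement absorb it.
  have h1 := mul_le_weighted_sq (x := lam - l (n + 1)) hmu (k := n + 1) (by positivity) (hd n)
  have h2 := mul_le_mul_of_nonneg_left h1 (hg n).le
  have h3 : 0 ≤ gammaSeq t0 n * (8 * L ^ 2 / (mu * (n + 1)) * (lam - l (n + 1)) ^ 2) := by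
    have := hg n
    positivity
  have h4 : 0 ≤ gammaSeq t0 n * (mu * (n + 1) / 8 * D n ^ 2) := by
    have := hg n
    positivity
  have h5 : 0 ≤ gammaSeq t0 n * etaSeq mu t0 n / 2 * a (n + 1) := by
    have := hg n
    have := ha (n + 1)
    rw [etaSeq]
    positivity
  have h6 : gammaSeq t0 n * tauSeq mu L n / 2 * (lam - l (n + 1)) ^ 2
      = 2 * (gammaSeq t0 n * (8 * L ^ 2 / (mu * (n + 1)) * (lam - l (n + 1)) ^ 2)) := by
    rw [tauSeq]; ring
  linarith

end Telescoping

/-! ### The one-step primal-dual inequality -/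

namespace Problem

variable {p d : ℕ} {P : Problem p d} {rhoF rhoG mu B : ℝ}

/-- An inexact inner solution can only overestimate the minimum, so the error is one-sided. -/
theorem GradLipschitz.hHat_bounds (h1 : P.GradLipschitz rhoF rhoG) (hP : P.Standing)
    {z : Pt p d} (hz : z ∈ P.Z) {y : EuclideanSpace ℝ (Fin d)} (hy : y ∈ P.Y) :
    P.h z - (P.Lg + P.alpha * P.RY) * ‖y - P.yStar z.fst‖ ≤ P.hHat z y ∧ P.hHat z y ≤ P.h z := by
  have h2 := hP.gStar_le hz.1 hy
  have h3 := h1.gReg_sub_le hP hz.1 hy (hP.yStar_spec hz.1).1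
  rw [← hP.gStar_eq hz.1] at h3
  simp only [hHat, h]
  constructor <;> linarith

theorem GradLipschitz.inner_gradH_le (h1 : P.GradLipschitz rhoF rhoG) (hP : P.Standing)
    {z v : Pt p d} (hz : z ∈ P.Z) {y : EuclideanSpace ℝ (Fin d)} (hy : y ∈ P.Y) :
    inner ℝ (P.gradH z) v ≤ inner ℝ (P.gradHHat z y) v
      + rhoG * ‖y - P.yStar z.fst‖ * ‖v‖ := by
  rw [gradH, inner_gradHHat, inner_gradHHat]
  have h2 := real_inner_le_norm (P.gradX (pt z.fst y) - P.gradX (pt z.fst (P.yStar z.fst))) v.fst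
  have h3 := h1.g_lip _ (pt_mem_Z hz.1 hy) _ (pt_mem_Z hz.1 (hP.yStar_spec hz.1).1)
  rw [pt_sub_pt, sub_self, norm_pt_zero_left] at h3
  have h4 : ‖P.gradX (pt z.fst y) - P.gradX (pt z.fst (P.yStar z.fst))‖
      ≤ rhoG * ‖y - P.yStar z.fst‖ := (WithLp.norm_fst_le _ (gradient P.g (pt z.fst y)
        - gradient P.g (pt z.fst (P.yStar z.fst)))).trans h3
  have h5 : ‖v.fst‖ ≤ ‖v‖ := WithLp.norm_fst_le _ v
  have h6 := mul_le_mul h4 h5 (norm_nonneg _) (mul_nonneg h1.rhoG_nonneg (norm_nonneg _))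
  rw [inner_sub_left] at h2
  linarith

theorem Standing.Lg_add_nonneg (hP : P.Standing) (hL : 0 < P.Lg) :
    0 ≤ P.Lg + P.alpha * P.RY := by
  obtain ⟨y, hy⟩ := hP.Y_nonempty
  have := mul_nonneg hP.alpha_pos.le ((norm_nonneg y).trans (hP.norm_le_RY hy))
  linarith

/-- Smoothness bounds the Lagrangian above at `b`, and convexity bounds it below at `w`, both from
linearizations at `a`. The last term is the price of using `gradHHat` in place of `gradH`. -/
theorem StrongConvexity.lagrangian_step_le (h2 : P.StrongConvexity mu)
    (h1 : P.GradLipschitz rhoF rhoG) (hP : P.Standing) {a b w : Pt p d} (ha : a ∈ P.Z)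
    (hb : b ∈ P.Z) (hw : w ∈ P.Z) {l : ℝ} (hl : l ∈ Set.Icc 0 B) {y : EuclideanSpace ℝ (Fin d)}
    (hy : y ∈ P.Y) {e : ℝ} (he : ‖y - P.yStar a.fst‖ ≤ e) :
    P.f b + l * P.h b - P.f w - l * P.h w
      ≤ inner ℝ (gradient P.f a + l • P.gradHHat a y) (b - w)
        + (rhoF + B * rhoH rhoG P.alpha) / 2 * ‖b - a‖ ^ 2 - mu / 2 * ‖w - a‖ ^ 2
        + rhoG * e * B * P.DZ := by
  have f1 := h2.f_lower h1 hP ha hw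
  have f2 := (abs_le.1 (h1.f_quad hP ha hb)).2
  have g1 := h2.add_inner_gradH_le h1 hP ha hw
  have g2 := (abs_le.1 (h1.abs_h_sub_sub_inner_le hP ha hb)).2
  -- The expansion of `h` only needs `2 * rhoG` as smoothness constant; the part of `rhoH` with `1 /
  -- alpha` is slack.
  have hrho : 2 * rhoG ≤ rhoH rhoG P.alpha := by
    have := div_nonneg (mul_self_nonneg rhoG) hP.alpha_pos.le
    rw [rhoH, mul_add, mul_div_assoc']
    linarith
  have g3 : l * (P.h b - P.h w) ≤ l * inner ℝ (P.gradH a) (b - w)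
      + B * (rhoH rhoG P.alpha / 2) * ‖b - a‖ ^ 2 := by
    have e1 : inner ℝ (P.gradH a) (b - w)
        = inner ℝ (P.gradH a) (b - a) - inner ℝ (P.gradH a) (w - a) := by
      rw [← inner_sub_right, sub_sub_sub_cancel_right]
    have i1 : P.h b - P.h w ≤ inner ℝ (P.gradH a) (b - w) + rhoG * ‖b - a‖ ^ 2 := by
      rw [e1]; linarith
    have i2 := mul_le_mul_of_nonneg_left i1 hl.1
    have i3 : l * rhoG ≤ B * (rhoH rhoG P.alpha / 2) :=
      mul_le_mul hl.2 (by linarith) h1.rhoG_nonneg (hl.1.trans hl.2)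
    have i4 := mul_le_mul_of_nonneg_right i3 (sq_nonneg ‖b - a‖)
    linarith
  have g4 := mul_le_mul_of_nonneg_left (h1.inner_gradH_le hP (v := b - w) ha hy) hl.1
  have g5 : l * (rhoG * ‖y - P.yStar a.fst‖ * ‖b - w‖) ≤ B * (rhoG * e * P.DZ) := by
    have he0 := (norm_nonneg _).trans he
    have hr := h1.rhoG_nonneg
    refine mul_le_mul hl.2 ?_ (by positivity) (hl.1.trans hl.2)
    exact mul_le_mul (mul_le_mul_of_nonneg_left he hr) (hP.norm_sub_le_DZ hb hw) (norm_nonneg _)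
      (mul_nonneg hr he0)
  have f3 : inner ℝ (gradient P.f a) (b - w)
        = inner ℝ (gradient P.f a) (b - a) - inner ℝ (gradient P.f a) (w - a) := by
    rw [← inner_sub_right, sub_sub_sub_cancel_right]
  rw [inner_add_left, real_inner_smul_left, f3]
  linarith

theorem dual_step_le {lam l tau W : ℝ} (htau : 0 < tau) (hlam : lam ∈ Set.Icc 0 B) :
    (lam - proj (Set.Icc 0 B) (l + (1 / tau) * W)) * W ≤ tau / 2 * ((lam - l) ^ 2
      - (proj (Set.Icc 0 B) (l + (1 / tau) * W) - l) ^ 2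
      - (lam - proj (Set.Icc 0 B) (l + (1 / tau) * W)) ^ 2) := by
  have h := inner_proj_step_le (K := Set.Icc 0 B) ⟨lam, hlam⟩ isClosed_Icc.isComplete
    (convex_Icc 0 B) htau l (-W) hlam
  have e : l - (1 / tau) • (-W) = l + (1 / tau) * W := by rw [smul_eq_mul]; ring
  rw [e] at h
  simp only [Real.norm_eq_abs, sq_abs, RCLike.inner_apply, conj_trivial] at h
  linarith

/-- The dual step sees an extrapolation of `h` from `z` and the previous point, not `h z'`. The
difference is the cross term in `lam - l'`. Here `hpe` is the exact previous value and `hp` its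
stored estimate. -/
theorem StrongConvexity.primal_dual_step_le (h2 : P.StrongConvexity mu)
    (h1 : P.GradLipschitz rhoF rhoG) (hP : P.Standing) (hL : 0 < P.Lg) {z w : Pt p d}
    (hz : z ∈ P.Z) (hw : w ∈ P.Z) {lam l eta tau theta : ℝ} (hlam : lam ∈ Set.Icc 0 B)
    (heta : 0 < eta) (htau : 0 < tau) (htheta : theta ∈ Set.Icc (0 : ℝ) 1)
    {y : EuclideanSpace ℝ (Fin d)} (hy : y ∈ P.Y) {e : ℝ} (he : ‖y - P.yStar z.fst‖ ≤ e)
    {hp hpe : ℝ} (hp1 : hpe - (P.Lg + P.alpha * P.RY) * e ≤ hp) (hp2 : hp ≤ hpe) {l' : ℝ}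
    (hl' : l' = proj (Set.Icc 0 B) (l + (1 / tau) * ((1 + theta) * P.hHat z y - theta * hp)))
    {z' : Pt p d}
    (hz' : z' = proj P.Z (z - (1 / eta) • (gradient P.f z + l' • P.gradHHat z y))) :
    P.f z' + lam * P.h z' - P.f w - l' * P.h w ≤
      (eta - mu) / 2 * ‖w - z‖ ^ 2 - eta / 2 * ‖w - z'‖ ^ 2
      - (eta - (rhoF + B * rhoH rhoG P.alpha)) / 2 * ‖z' - z‖ ^ 2
      + (lam - l') * ((P.h z' - P.h z) - theta * (P.h z - hpe))
      + tau / 2 * ((lam - l) ^ 2 - (l' - l) ^ 2 - (lam - l') ^ 2)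
      + (rhoG * P.DZ + 2 * (P.Lg + P.alpha * P.RY)) * B * e := by
  have hl'mem : l' ∈ Set.Icc 0 B := by
    rw [hl']
    exact (proj_mem_and_le ⟨lam, hlam⟩ isClosed_Icc.isComplete (convex_Icc 0 B) _).1
  have hz'mem : z' ∈ P.Z := by
    rw [hz']
    exact (proj_mem_and_le hP.Z_nonempty hP.Z_compact.isComplete hP.Z_convex _).1
  have s1 := h2.lagrangian_step_le h1 hP hz hz'mem hw hl'mem hy he
  have s2 := inner_proj_step_le hP.Z_nonempty hP.Z_compact.isComplete hP.Z_convex heta z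
    (gradient P.f z + l' • P.gradHHat z y) hw
  have s3 := dual_step_le (l := l) (W := (1 + theta) * P.hHat z y - theta * hp) htau hlam
  rw [← hz'] at s2
  rw [← hl'] at s3
  obtain ⟨b1, b2⟩ := h1.hHat_bounds hP hz hy
  have hE := hP.Lg_add_nonneg hL
  have b3 := mul_le_mul_of_nonneg_left he hE
  set E := (P.Lg + P.alpha * P.RY) * e
  have hE0 : 0 ≤ E := mul_nonneg hE ((norm_nonneg _).trans he)
  -- Both estimation errors lie in `[0, E]`, so the bracket is at most `(1 + theta) * E` in absolute
  -- value.
  have s4 : (lam - l') * ((1 + theta) * (P.h z - P.hHat z y) - theta * (hpe - hp)) ≤ B * (2 * E) := by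
    refine (le_abs_self _).trans ?_
    rw [abs_mul]
    refine mul_le_mul (abs_le.2 ?_) (abs_le.2 ?_) (abs_nonneg _) (hlam.1.trans hlam.2)
    · constructor <;> linarith [hlam.1, hlam.2, hl'mem.1, hl'mem.2]
    · obtain ⟨t1, t2⟩ := htheta
      constructor <;> nlinarith
  have e4 : (rhoG * P.DZ + 2 * (P.Lg + P.alpha * P.RY)) * B * e
      = rhoG * e * B * P.DZ + B * (2 * E) := by simp only [E]; ring
  rw [e4]
  linarith

end Problem

/-! ### The trajectory and its gap -/

section Run

open Problem

variable {p d : ℕ} {P : Problem p d} {rhoF rhoG mu B : ℝ}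

theorem run_mem (hP : P.Standing) {eta tau theta : ℕ → ℝ} {N : ℕ}
    {yinit : ℕ → EuclideanSpace ℝ (Fin d)} {z0 : Pt p d} (hz0 : z0 ∈ P.Z) {lam0 : ℝ} :
    ∀ t, (run P rhoG B eta tau theta N yinit z0 lam0 t).z ∈ P.Z
  | 0 => hz0
  | _ + 1 => (proj_mem_and_le hP.Z_nonempty hP.Z_compact.isComplete hP.Z_convex _).1

theorem run_lam_mem (hB : 0 ≤ B) {eta tau theta : ℕ → ℝ} {N : ℕ}
    {yinit : ℕ → EuclideanSpace ℝ (Fin d)} {z0 : Pt p d} {lam0 : ℝ} (hlam0 : lam0 ∈ Set.Icc 0 B) :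
    ∀ t, (run P rhoG B eta tau theta N yinit z0 lam0 t).lam ∈ Set.Icc 0 B
  | 0 => hlam0
  | _ + 1 => (proj_mem_and_le (Set.nonempty_Icc.2 hB) isClosed_Icc.isComplete (convex_Icc 0 B) _).1

/-- Truncated subtraction encodes the convention that the value at time `-1` is the one at time `0`.
-/
theorem run_hPrev {eta tau theta : ℕ → ℝ} {N : ℕ}
    {yinit : ℕ → EuclideanSpace ℝ (Fin d)} {z0 : Pt p d} {lam0 : ℝ} :
    ∀ t, (run P rhoG B eta tau theta N yinit z0 lam0 t).hPrev =
      P.hHat (run P rhoG B eta tau theta N yinit z0 lam0 (t - 1)).z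
        (P.innerIter rhoG (run P rhoG B eta tau theta N yinit z0 lam0 (t - 1)).z.fst
          (yinit (t - 1)) N)
  | 0 => rfl
  | _ + 1 => rfl

theorem average_spec {gamma : ℕ → ℝ} {z : ℕ → Pt p d} {S : Set (Pt p d)} {F : Pt p d → ℝ}
    (hF : ConvexOn ℝ S F) (hg : ∀ t, 0 < gamma t) (hz : ∀ t, z t ∈ S) {T : ℕ} (hT : 1 ≤ T) :
    average gamma z T ∈ S ∧ (∑ t ∈ Finset.range T, gamma t) * F (average gamma z T)
      ≤ ∑ t ∈ Finset.range T, gamma t * F (z (t + 1)) := by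
  have hpos : 0 < ∑ t ∈ Finset.range T, gamma t :=
    Finset.sum_pos (fun t _ => hg t) (Finset.nonempty_range_iff.2 (by omega))
  have e : average gamma z T = (Finset.range T).centerMass gamma fun t => z (t + 1) := by
    rw [average, Finset.centerMass, one_div]
  rw [e]
  refine ⟨hF.1.centerMass_mem (fun t _ => (hg t).le) hpos fun t _ => hz _, ?_⟩
  have h := hF.map_centerMass_le (t := Finset.range T) (w := gamma) (p := fun t => z (t + 1))
    (fun t _ => (hg t).le) hpos fun t _ => hz _
  refine (mul_le_mul_of_nonneg_left h hpos.le).trans_eq ?_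
  rw [Finset.centerMass, smul_eq_mul, mul_inv_cancel_left₀ hpos.ne']
  simp

theorem Problem.StrongConvexity.mul_norm_sq_nonneg (h2 : P.StrongConvexity mu)
    (h1 : P.GradLipschitz rhoF rhoG) (hP : P.Standing) {a b : Pt p d} (ha : a ∈ P.Z)
    (hb : b ∈ P.Z) : 0 ≤ (rhoF - mu) * ‖a - b‖ ^ 2 := by
  have f1 := h2.f_lower h1 hP hb ha
  have f2 := (abs_le.1 (h1.f_quad hP hb ha)).2
  linarith

theorem Problem.GradLipschitz.rhoH_nonneg (h1 : P.GradLipschitz rhoF rhoG) (hP : P.Standing) :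
    0 ≤ rhoH rhoG P.alpha := by
  have := h1.rhoG_nonneg
  have := hP.alpha_pos
  rw [rhoH]
  positivity

/-- The weight `η₀ - μ` is nonnegative unless `Z` is a single point. -/
theorem Problem.StrongConvexity.etaSeq_sub_mul_bounds (h2 : P.StrongConvexity mu)
    (h1 : P.GradLipschitz rhoF rhoG) (hP : P.Standing) (hB : 0 ≤ B) {a b : Pt p d} (ha : a ∈ P.Z)
    (hb : b ∈ P.Z) :
    0 ≤ (etaSeq mu (shift mu rhoF rhoG P.alpha B) 0 - mu) * ‖a - b‖ ^ 2 ∧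
    (etaSeq mu (shift mu rhoF rhoG P.alpha B) 0 - mu) * ‖a - b‖ ^ 2
      ≤ (etaSeq mu (shift mu rhoF rhoG P.alpha B) 0 - mu) * P.DZ ^ 2 := by
  have hmu := h2.mu_pos
  have e : etaSeq mu (shift mu rhoF rhoG P.alpha B) 0 - mu
      = rhoF + B * rhoH rhoG P.alpha - mu / 2 := by
    rw [etaSeq, shift]; field_simp; push_cast; ring
  have hr := mul_nonneg hB (h1.rhoH_nonneg hP)
  rw [e]
  rcases le_or_gt 0 (rhoF + B * rhoH rhoG P.alpha - mu / 2) with hc | hc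
  · exact ⟨by positivity, mul_le_mul_of_nonneg_left
      (pow_le_pow_left₀ (norm_nonneg _) (hP.norm_sub_le_DZ ha hb) 2) hc⟩
  · have hsub : P.Z.Subsingleton := by
      intro x hx y hy
      have h3 := h2.mul_norm_sq_nonneg h1 hP hx hy
      have h4 : ‖x - y‖ ^ 2 = 0 := by
        have := sq_nonneg ‖x - y‖
        have hneg : rhoF - mu < 0 := by linarith
        nlinarith
      exact sub_eq_zero.1 (norm_eq_zero.1 (pow_eq_zero_iff two_ne_zero |>.1 h4))
    have hD : P.DZ = 0 := Metric.diam_subsingleton hsub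
    rw [hD, hsub ha hb]
    simp

/-- The primal-dual gap bound from which the convergence guarantees follow. -/
theorem gap_le (hP : P.Standing) (h1 : P.GradLipschitz rhoF rhoG) (h2 : P.StrongConvexity mu)
    (hL : 0 < P.Lg) (hB : 0 ≤ B) {zs : Pt p d} (hzs : zs ∈ P.Z) (hhs : P.h zs ≤ 0)
    {z0 : Pt p d} {lam0 : ℝ} {yinit : ℕ → EuclideanSpace ℝ (Fin d)} {T N : ℕ}
    (hz0 : z0 ∈ P.Z) (hlam0 : lam0 ∈ Set.Icc 0 B) (hyinit : ∀ t, yinit t ∈ P.Y) (hT : 1 ≤ T)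
    {t0 : ℝ} (ht0 : t0 = shift mu rhoF rhoG P.alpha B) {lam : ℝ} (hlam : lam ∈ Set.Icc 0 B)
    {zbar : Pt p d} (hzbar : zbar = average (gammaSeq t0) (fun t => (run P rhoG B (etaSeq mu t0)
      (tauSeq mu P.Lg) (thetaSeq t0) N yinit z0 lam0 t).z) T) :
    P.f zbar + lam * P.h zbar - P.f zs ≤
      (gammaSeq t0 0 * tauSeq mu P.Lg 0 * (lam - lam0) ^ 2
        + gammaSeq t0 0 * (etaSeq mu t0 0 - mu) * ‖zs - z0‖ ^ 2) / (T : ℝ) ^ 2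
      + (rhoG * P.DZ + 4 * (P.Lg + P.alpha * P.RY)) * B * P.DZ *
        (1 - P.alpha / (rhoG + 2 * P.alpha)) ^ N := by
  have hmu := h2.mu_pos
  have hr := mul_nonneg hB (h1.rhoH_nonneg hP)
  have ht0' : 0 ≤ t0 := by
    rw [ht0, shift]
    have := h1.rhoF_nonneg
    positivity
  have hg : ∀ t, 0 < gammaSeq t0 t := fun t => by rw [gammaSeq]; positivity
  set st := run P rhoG B (etaSeq mu t0) (tauSeq mu P.Lg) (thetaSeq t0) N yinit z0 lam0 with hst
  have hz : ∀ t, (st t).z ∈ P.Z := run_mem hP hz0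
  have hl : ∀ t, (st t).lam ∈ Set.Icc 0 B := run_lam_mem hB hlam0
  set e := P.DZ * (1 - P.alpha / (rhoG + 2 * P.alpha)) ^ N with he
  let yh : ℕ → EuclideanSpace ℝ (Fin d) := fun t => P.innerIter rhoG (st t).z.fst (yinit t) N
  have hyh : ∀ t, yh t ∈ P.Y := fun t => hP.innerIter_mem _ (hyinit t) N
  have hye : ∀ t, ‖yh t - P.yStar (st t).z.fst‖ ≤ e := fun t =>
    h1.norm_innerIter_sub_yStar_le hP (hz t).1 (hyinit t) N
  have he0 : 0 ≤ e := (norm_nonneg _).trans (hye 0)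
  have hE := hP.Lg_add_nonneg hL
  have hsum := sum_gammaSeq_mul_le (L := P.Lg) (lam := lam) (l := fun t => (st t).lam)
    (a := fun t => ‖zs - (st t).z‖ ^ 2) (D := fun t => ‖(st (t + 1)).z - (st t).z‖)
    (dd := fun t => P.h (st t).z - P.h (st (t - 1)).z)
    (Q := fun t => P.f (st (t + 1)).z + lam * P.h (st (t + 1)).z - P.f zs
      - (st (t + 1)).lam * P.h zs)
    (eps := (rhoG * P.DZ + 2 * (P.Lg + P.alpha * P.RY)) * B * e)
    hmu ht0' (fun t => sq_nonneg _) (by simp)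
    (fun t => h2.abs_h_sub_le h1 hP (hz (t + 1)) (hz t)) (fun t => ?_) hT
  · set Γ := ∑ t ∈ Finset.range T, gammaSeq t0 t
    have hΓ := sum_gammaSeq_ge ht0' T
    have hT0 : (0 : ℝ) < (T : ℝ) ^ 2 := by positivity
    have hΓ0 : 0 < Γ := lt_of_lt_of_le (by positivity) hΓ
    have hconv : ConvexOn ℝ P.Z fun z => P.f z + lam * P.h z :=
      (h2.f_strong.convexOn fun r => by positivity).add (h2.h_convex.smul hlam.1)
    have hav := (average_spec hconv hg hz hT).2
    rw [← hzbar] at hav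
    have hdrop : ∑ t ∈ Finset.range T, gammaSeq t0 t * (P.f (st (t + 1)).z
        + lam * P.h (st (t + 1)).z) - Γ * P.f zs ≤ ∑ t ∈ Finset.range T, gammaSeq t0 t *
        (P.f (st (t + 1)).z + lam * P.h (st (t + 1)).z - P.f zs - (st (t + 1)).lam * P.h zs) := by
      rw [Finset.sum_mul, ← Finset.sum_sub_distrib]
      refine Finset.sum_le_sum fun t _ => ?_
      have := mul_nonneg (hg t).le (mul_nonneg (hl (t + 1)).1 (neg_nonneg.2 hhs))
      linarith
    -- The sign matters: `Γ` is only bounded below by `T² / 2`, so dividing by it needs a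
    -- nonnegative numerator.
    have hA : 0 ≤ gammaSeq t0 0 * tauSeq mu P.Lg 0 * (lam - lam0) ^ 2
        + gammaSeq t0 0 * (etaSeq mu t0 0 - mu) * ‖zs - z0‖ ^ 2 := by
      have i1 := (h2.etaSeq_sub_mul_bounds h1 hP hB hzs hz0).1
      rw [← ht0] at i1
      have i2 : 0 ≤ gammaSeq t0 0 * tauSeq mu P.Lg 0 * (lam - lam0) ^ 2 := by
        have := hg 0
        rw [tauSeq]
        positivity
      have i3 := mul_nonneg (hg 0).le i1
      linarith
    have e1 : (st 0).lam = lam0 := rfl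
    have e2 : (st 0).z = z0 := rfl
    simp only [e1, e2] at hsum
    set A := gammaSeq t0 0 * tauSeq mu P.Lg 0 * (lam - lam0) ^ 2
        + gammaSeq t0 0 * (etaSeq mu t0 0 - mu) * ‖zs - z0‖ ^ 2
    have hfin : Γ * (P.f zbar + lam * P.h zbar - P.f zs)
        ≤ Γ * (A / (T : ℝ) ^ 2 + (rhoG * P.DZ + 2 * (P.Lg + P.alpha * P.RY)) * B * e) := by
      have i1 : A / 2 ≤ Γ * (A / (T : ℝ) ^ 2) := by
        calc A / 2 = (T : ℝ) ^ 2 / 2 * (A / (T : ℝ) ^ 2) := by field_simp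
          _ ≤ _ := mul_le_mul_of_nonneg_right hΓ (by positivity)
      linarith
    refine (le_of_mul_le_mul_left hfin hΓ0).trans ?_
    -- The argument yields the factor 2 where the stated bias has 4.
    have i2 : 0 ≤ 2 * (P.Lg + P.alpha * P.RY) * B * e := by positivity
    have e3 : (rhoG * P.DZ + 4 * (P.Lg + P.alpha * P.RY)) * B * P.DZ *
        (1 - P.alpha / (rhoG + 2 * P.alpha)) ^ N
        = (rhoG * P.DZ + 2 * (P.Lg + P.alpha * P.RY)) * B * e
          + 2 * (P.Lg + P.alpha * P.RY) * B * e := by rw [he]; ring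
    rw [e3]
    linarith
  · have hprev : (st t).hPrev = P.hHat (st (t - 1)).z (yh (t - 1)) := run_hPrev t
    obtain ⟨b1, b2⟩ := h1.hHat_bounds hP (hz (t - 1)) (hyh (t - 1))
    have b3 := mul_le_mul_of_nonneg_left (hye (t - 1)) hE
    have hθ : thetaSeq t0 t ∈ Set.Icc (0 : ℝ) 1 := by
      rw [thetaSeq]
      exact ⟨by positivity, (div_le_one (by positivity)).2 (by linarith)⟩
    have key := h2.primal_dual_step_le (B := B) h1 hP hL (hz t) hzs (l := (st t).lam)
      (eta := etaSeq mu t0 t) (tau := tauSeq mu P.Lg t) hlam (by rw [etaSeq]; positivity)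
      (by rw [tauSeq]; positivity) hθ (hyh t) (hye t) (hp := (st t).hPrev)
      (hpe := P.h (st (t - 1)).z) (by rw [hprev]; linarith) (by rw [hprev]; exact b2)
      (l' := (st (t + 1)).lam) rfl (z' := (st (t + 1)).z) rfl
    -- The shift `t0` makes `mu * t0 / 2` equal to the smoothness constant of the Lagrangian; the
    -- rest of `η_t` controls the movement term.
    have e1 : (etaSeq mu t0 t - (rhoF + B * rhoH rhoG P.alpha)) / 2 = mu * (t + 1) / 4 := by
      have : rhoF + B * rhoH rhoG P.alpha = mu * t0 / 2 := by
        rw [ht0, shift]; field_simp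
      rw [this, etaSeq]; ring
    rw [e1] at key
    exact key

theorem exists_lagrange_multiplier (hP : P.Standing) (h2 : P.StrongConvexity mu)
    {zs : Pt p d} (hzs : P.IsSolution zs) :
    ∃ l, 0 ≤ l ∧ l ≤ P.Df / P.delta ∧ ∀ z ∈ P.Z, P.f zs ≤ P.f z + l * P.h z := by
  obtain ⟨x, hx⟩ := hP.X_nonempty
  have hmem := pt_mem_Z hx (hP.yStar_spec hx).1
  exact exists_multiplier (h2.f_strong.convexOn fun r => by have := h2.mu_pos; positivity)
    h2.h_convex hP.delta_pos hzs.2.2 hmem (hP.h_yStar_le hx)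
    ((le_abs_self _).trans (hP.abs_sub_le_Df hmem hzs.1))

/-- Quadratic growth: `zs` minimizes the strongly convex Lagrangian at `l`, so its expansion with
zero linear part applies. -/
theorem norm_sub_sq_le_of_multiplier (h2 : P.StrongConvexity mu)
    {zs : Pt p d} (hzs : P.IsSolution zs) {l : ℝ} (hl0 : 0 ≤ l)
    (hl : ∀ z ∈ P.Z, P.f zs ≤ P.f z + l * P.h z) {z : Pt p d} (hz : z ∈ P.Z) :
    mu / 2 * ‖z - zs‖ ^ 2 ≤ P.f z + l * P.h z - P.f zs := by
  have hs : StrongConvexOn P.Z mu fun z => P.f z + l * P.h z := by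
    have := UniformConvexOn.add h2.f_strong (uniformConvexOn_zero.2 (h2.h_convex.smul hl0))
    rwa [add_zero] at this
  have hle : l * P.h zs ≤ 0 := mul_nonpos_of_nonneg_of_nonpos hl0 hzs.2.1
  have := StrongConvexOn.add_inner_le hs (v := 0) (C := 0) hzs.1 hz fun w hw => by
    have := hl w hw
    simp only [inner_zero_left]
    linarith
  simp only [inner_zero_left] at this
  have h3 := hl zs hzs.1
  linarith

end Run

end PDBO

/-! ### The three guarantees -/

open PDBO

theorem theorem1 {p d : ℕ} (P : PDBO.Problem p d) (rhoF rhoG mu B : ℝ)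
    (hP : P.Standing) (h1 : P.GradLipschitz rhoF rhoG) (h2 : P.StrongConvexity mu)
    (hL : 0 < P.Lg) (hB : P.Df / P.delta + 1 ≤ B) :
    (∃! zs, P.IsSolution zs) ∧
    ∀ zs, P.IsSolution zs →
    ∀ (z0 : PDBO.Pt p d) (lam0 : ℝ) (yinit : ℕ → EuclideanSpace ℝ (Fin d)) (T N : ℕ),
      z0 ∈ P.Z → lam0 ∈ Set.Icc 0 B → (∀ t, yinit t ∈ P.Y) → 1 ≤ T →
      let t0 := PDBO.shift mu rhoF rhoG P.alpha B
      let gamma := PDBO.gammaSeq t0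
      let eta := PDBO.etaSeq mu t0
      let tau := PDBO.tauSeq mu P.Lg
      let theta := PDBO.thetaSeq t0
      let zbar := PDBO.average gamma
        (fun t => (PDBO.run P rhoG B eta tau theta N yinit z0 lam0 t).z) T
      let bias := (rhoG * P.DZ + 4 * (P.Lg + P.alpha * P.RY)) * B * P.DZ *
        (1 - P.alpha / (rhoG + 2 * P.alpha)) ^ N
      P.f zbar - P.f zs ≤
          (2 * P.Lg * B * P.DZ + gamma 0 * tau 0 * lam0 ^ 2
            + gamma 0 * (eta 0 - mu) * ‖zs - z0‖ ^ 2) / (T : ℝ) ^ 2 + bias ∧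
      max (P.h zbar) 0 ≤
          (2 * P.Lg * B * P.DZ + gamma 0 * tau 0 * B ^ 2
            + gamma 0 * (eta 0 - mu) * P.DZ ^ 2) / (T : ℝ) ^ 2 + bias ∧
      ‖zbar - zs‖ ^ 2 ≤
          (2 * (gamma 0 * tau 0) * B ^ 2 + 2 * (gamma 0 * (eta 0 - mu)) * P.DZ ^ 2)
            / (mu * (T : ℝ) ^ 2) + 2 / mu * bias := by
  refine ⟨hP.exists_unique_isSolution h1 h2, ?_⟩
  intro zs hzs z0 lam0 yinit T N hz0 hlam0 hyinit hT t0 gamma eta tau theta zbar bias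
  have hmu := h2.mu_pos
  have hDf : 0 ≤ P.Df / P.delta := div_nonneg hP.Df_nonneg hP.delta_pos.le
  have hB0 : 0 ≤ B := by linarith
  have hT0 : (0 : ℝ) < (T : ℝ) ^ 2 := by positivity
  have hgap := fun {lam : ℝ} (hlam : lam ∈ Set.Icc 0 B) =>
    gap_le (N := N) hP h1 h2 hL hB0 hzs.1 hzs.2.1 hz0 hlam0 hyinit hT (t0 := t0) rfl hlam
      (zbar := zbar) rfl
  have ht0 : 0 ≤ t0 := div_nonneg (mul_nonneg zero_le_two
    (add_nonneg h1.rhoF_nonneg (mul_nonneg hB0 (h1.rhoH_nonneg hP)))) hmu.le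
  have hg : ∀ t, 0 < gamma t := fun t => by simp only [gamma, gammaSeq]; positivity
  have hgt : 0 ≤ gamma 0 * tau 0 := mul_nonneg (hg 0).le (by simp only [tau, tauSeq]; positivity)
  have hzb : zbar ∈ P.Z := (average_spec h2.h_convex hg (run_mem hP hz0) hT).1
  obtain ⟨i1, i2⟩ := h2.etaSeq_sub_mul_bounds h1 hP hB0 hzs.1 hz0
  have j1 : 0 ≤ gamma 0 * (eta 0 - mu) * ‖zs - z0‖ ^ 2 := by
    rw [mul_assoc]; exact mul_nonneg (hg 0).le i1
  have j2 : gamma 0 * (eta 0 - mu) * ‖zs - z0‖ ^ 2 ≤ gamma 0 * (eta 0 - mu) * P.DZ ^ 2 := by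
    rw [mul_assoc, mul_assoc]; exact mul_le_mul_of_nonneg_left i2 (hg 0).le
  have hLB : 0 ≤ 2 * P.Lg * B * P.DZ := by
    have : 0 ≤ P.DZ := Metric.diam_nonneg
    positivity
  obtain ⟨l, hl0, hl1, hl⟩ := exists_lagrange_multiplier hP h2 hzs
  -- The `+ 1` in the lower bound on `B` admits `l + 1` as a dual value.
  have hlB : l + 1 ≤ B := by linarith
  have hsq : ∀ lam ∈ Set.Icc 0 B, gamma 0 * tau 0 * (lam - lam0) ^ 2 ≤ gamma 0 * tau 0 * B ^ 2 := by
    intro lam hlam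
    refine mul_le_mul_of_nonneg_left (sq_le_sq' ?_ ?_) hgt <;>
      linarith [hlam.1, hlam.2, hlam0.1, hlam0.2]
  have hdist := norm_sub_sq_le_of_multiplier h2 hzs hl0 hl hzb
  have hbound : ∀ lam ∈ Set.Icc 0 B, P.f zbar + lam * P.h zbar - P.f zs ≤
      (gamma 0 * tau 0 * B ^ 2 + gamma 0 * (eta 0 - mu) * P.DZ ^ 2) / (T : ℝ) ^ 2 + bias := by
    intro lam hlam
    refine (hgap hlam).trans (add_le_add_left ?_ _)
    exact div_le_div_of_nonneg_right (add_le_add (hsq lam hlam) j2) hT0.le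
  have hb1 := hbound l ⟨hl0, by linarith⟩
  have hb2 := hbound (l + 1) ⟨by linarith, hlB⟩
  refine ⟨?_, ?_, ?_⟩
  · have h := hgap (lam := 0) ⟨le_rfl, hB0⟩
    rw [zero_mul, add_zero, zero_sub, neg_sq] at h
    refine h.trans (add_le_add_left ?_ _)
    exact div_le_div_of_nonneg_right (by linarith) hT0.le
  · have hmono : (gamma 0 * tau 0 * B ^ 2 + gamma 0 * (eta 0 - mu) * P.DZ ^ 2) / (T : ℝ) ^ 2 + bias
        ≤ (2 * P.Lg * B * P.DZ + gamma 0 * tau 0 * B ^ 2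
            + gamma 0 * (eta 0 - mu) * P.DZ ^ 2) / (T : ℝ) ^ 2 + bias :=
      add_le_add_left (div_le_div_of_nonneg_right (by linarith) hT0.le) _
    have hpos : 0 ≤ mu / 2 * ‖zbar - zs‖ ^ 2 := by positivity
    refine max_le ?_ ?_ <;> refine le_trans ?_ hmono
    · linarith
    · linarith
  · have h := hdist.trans hb1
    have e : (2 * (gamma 0 * tau 0) * B ^ 2 + 2 * (gamma 0 * (eta 0 - mu)) * P.DZ ^ 2)
            / (mu * (T : ℝ) ^ 2) + 2 / mu * bias
        = 2 / mu * ((gamma 0 * tau 0 * B ^ 2 + gamma 0 * (eta 0 - mu) * P.DZ ^ 2) / (T : ℝ) ^ 2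
          + bias) := by
      field_simp
    rw [e]
    calc ‖zbar - zs‖ ^ 2 = 2 / mu * (mu / 2 * ‖zbar - zs‖ ^ 2) := by field_simp
      _ ≤ _ := mul_le_mul_of_nonneg_left h (by positivity)
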